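/- Let $n\ge 2$, let $W=\mathbb C^n$ have standard basis $w_1,\dots,w_n$, and for $\varepsilon\in\mathbb C$ let $M(\varepsilon):W\to W$ be the linear map with $M(\varepsilon)w_i=w_{i-1}$ for $i>1$ and $M(\varepsilon)w_1=\varepsilon w_n$. Let $\mathbf J=(J_b)_{b\in\mathbb Z_n}$ be a $(1,n)$ juggling pattern: $J_b\in\{1,\dots,n\}$, and $J_{b+1}=J_b-1$ whenever $J_b>1$. Put $L=\{b\in\mathbb Z_n: J_b=1\}$. The global positroid family $\underline\Pi_{\mathbf J}\subset\mathbb A^1\times\prod_{b\in\mathbb Z_n}\mathbb P(W)$ consists of all $(\varepsilon,(U_b)_b)$, with $U_b\subset W$ lines, such that $M(\varepsilon)U_b\subset U_{b+1}$ and $U_b\subset\mathrm{span}\{w_i: i\ge J_b\}$ for all $b$; its fiber over $\varepsilon$ is $\Pi_{\mathbf J}(\varepsilon)\subset\prod_b\mathbb P(W)$. Let $\Delta^{(b)}_i$ be the homogeneous coordinates on the $b$-th factor, let $\underline{\mathcal I}\subset\mathbb C[\varepsilon,\Delta^{(b)}_i]$ be the ideal of all polynomials vanishing at all homogeneous coordinates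 of all points of $\underline\Pi_{\mathbf J}$, and let $\mathcal I(\varepsilon)\subset\mathbb C[\Delta^{(b)}_i]$ be the analogous ideal of $\Pi_{\mathbf J}(\varepsilon)$. Let $\underline{Pl}=\mathbb C[\varepsilon,\Delta^{(b)}_i]/\underline{\mathcal I}$ be the global Plücker algebra; the multidegree $\mathbf m\in\mathbb Z_{\ge0}^{\mathbb Z_n}$ of a monomial counts, for each $b$, its factors of the form $\Delta^{(b)}_\bullet$. A monomial in the variables $\Delta^{(b)}_i$ is called $\mathbf J$-admissible if (a) $b+i-1\in L$ for every variable $\Delta^{(b)}_i$ that occurs in it, and (b) whenever $\Delta^{(b)}_i$ occurs and $1\le s\le n-1$, $i>s$, every $\Delta^{(b+s)}_r$ that occurs satisfies $r\le i-s$. For $c\in\mathbb Z_n$ with representative $\bar c\in\{0,\dots,n-1\}$ and $i\in\{1,\dots,n\}$ let $i-c$ and $i+c$ denote the cyclic shifts, taken in $\{1,\dots,n\}$ modulo $n$, and put $d_c(i)=1$ if $i\le\bar c$, $d_c(i)=0$ otherwise. Let $\mathcal I^{\rm rel}$ be the ideal of $\mathbb C[\varepsilon,\Delta^{(b)}_i]$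 generated by * $\Delta^{(a)}_i$ for $a\in\mathbb Z_n$, $i<J_a$; * $\Delta^{(a)}_i\Delta^{(a+c)}_j-\varepsilon^{d_c(j+c)-d_c(i)}\Delta^{(a)}_{j+c}\Delta^{(a+c)}_{i-c}$ for $a,c\in\mathbb Z_n$, $d_c(j+c)\ge d_c(i)$; * $\varepsilon^{d_c(i)-d_c(j+c)}\Delta^{(a)}_i\Delta^{(a+c)}_j-\Delta^{(a)}_{j+c}\Delta^{(a+c)}_{i-c}$ for $a,c\in\mathbb Z_n$, $d_c(j+c)<d_c(i)$; and for $\varepsilon_0\in\mathbb C$ let $\mathcal I^{\rm rel}(\varepsilon_0)$ be the ideal of $\mathbb C[\Delta^{(b)}_i]$ generated by the specializations of these relations at $\varepsilon=\varepsilon_0$. **Theorem.** 1. The (classes of the) $\mathbf J$-admissible monomials form a free $\mathbb C[\varepsilon]$-basis of $\underline{Pl}$. Moreover $\underline{Pl}=\bigoplus_{\mathbf m}Pl(\mathbf m)$ is multigraded, and for each $\mathbf m$ the admissible monomials of multidegree $\mathbf m$ form a free $\mathbb C[\varepsilon]$-basis of $Pl(\mathbf m)$. 2. The closed subscheme of $\mathbb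 A^1\times\prod_b\mathbb P(W)$ defined by $\mathcal I^{\rm rel}$ is $\underline\Pi_{\mathbf J}$ with its reduced scheme structure. That is, on each affine chart $\Delta^{(b)}_{\sigma(b)}=1$ ($b\in\mathbb Z_n$), where $\sigma:\mathbb Z_n\to\{1,\dots,n\}$, the image of $\mathcal I^{\rm rel}$ is the ideal of all functions vanishing on the part of $\underline\Pi_{\mathbf J}$ in this chart. Moreover $\mathcal I^{\rm rel}\subset\underline{\mathcal I}$, and the two ideals coincide in every multidegree $\mathbf m$ with $m_c>0$ for all $c\notin L$ (in particular, in every multidegree if all $J_b=1$). 3. For every $\varepsilon\in\mathbb C$, in the same sense, the closed subscheme of $\prod_b\mathbb P(W)$ defined by $\mathcal I^{\rm rel}(\varepsilon)$ is $\Pi_{\mathbf J}(\varepsilon)$ with its reduced scheme structure; moreover $\mathcal I^{\rm rel}(\varepsilon)\subset\mathcal I(\varepsilon)$, and the two ideals coincide in every multidegree $\mathbf m$ with $m_c>0$ for all $c\notin L$. -/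

import Mathlib

/-!
Conventions. The vertices `b ∈ ℤ_n` are elements of `ZMod n`. An index from `[n] = {1, …, n}` is
an element of `Fin n`, with `i : Fin n` standing for the number `(i : ℕ) + 1`; so `1 ∈ [n]`
is `0 : Fin n` and `n ∈ [n]` is the last element of `Fin n`.
-/

namespace GlobalPositroid

noncomputable section

/-- The `n`-dimensional complex vector space with its standard basis `w_1, …, w_n`. -/
abbrev W (n : ℕ) : Type := Fin n → ℂ

/-- The basis vector `w_i`. -/
def w {n : ℕ} (i : Fin n) : W n := Pi.single i 1

/-- A `(1, n)` juggling pattern: one-element sets `J_b ⊆ [n]` such that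
`{j - 1 : j ∈ J_b, j > 1} ⊆ J_{b+1}`. -/
def IsJugglingPattern {n : ℕ} (J : ZMod n → Fin n) : Prop :=
  ∀ b : ZMod n, 0 < (J b : ℕ) → (J (b + 1) : ℕ) = (J b : ℕ) - 1

/-- `L(J)`, the set of vertices `b` with `J_b = 1`. -/
def L {n : ℕ} (J : ZMod n → Fin n) : Set (ZMod n) := {b | (J b : ℕ) = 0}

/-! ### The varieties -/

/-- The linear map `M_{b → b+1}(ε)`: it sends `w_i` to `w_{i-1}` for `i > 1`, and `w_1` to
`ε w_n`. -/
def quiverMap {n : ℕ} (ε : ℂ) : W n →ₗ[ℂ] W n :=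
  (Pi.basisFun ℂ (Fin n)).constr ℂ fun i : Fin n =>
    if (i : ℕ) = 0 then ε • w (⟨n - 1, by have := i.isLt; omega⟩ : Fin n)
    else w (⟨(i : ℕ) - 1, by have := i.isLt; omega⟩ : Fin n)

/-- The opposite Schubert variety `X⁻_j` in `Gr_{1,n} = ℙ(W)`: the lines contained in the span of
the `w_i` with `i ≥ j`. -/
def oppositeSchubert {n : ℕ} (j : Fin n) : Set (Projectivization ℂ (W n)) :=
  {U | U.submodule ≤ Submodule.span ℂ {v | ∃ i : Fin n, j ≤ i ∧ v = w i}}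

/-- The global Grassmannian for `k = 1`: the collections `(ε, (U_b)_b)` of lines with
`M_{b → b+1}(ε) U_b ⊆ U_{b+1}` for all `b`. -/
def globalGrassmannian (n : ℕ) : Set (ℂ × (ZMod n → Projectivization ℂ (W n))) :=
  {p | ∀ b : ZMod n, (p.2 b).submodule.map (quiverMap p.1) ≤ (p.2 (b + 1)).submodule}

/-- The global positroid variety: the part of the global Grassmannian where `U_b ∈ X⁻_{J_b}` for
all `b`. -/
def globalPositroid {n : ℕ} (J : ZMod n → Fin n) :
    Set (ℂ × (ZMod n → Projectivization ℂ (W n))) :=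
  {p | p ∈ globalGrassmannian n ∧ ∀ b : ZMod n, p.2 b ∈ oppositeSchubert (J b)}

/-- The fiber over `ε` of the projection of the global positroid variety to the affine line. -/
def positroidFiber {n : ℕ} (J : ZMod n → Fin n) (ε : ℂ) :
    Set (ZMod n → Projectivization ℂ (W n)) :=
  {U | (ε, U) ∈ globalPositroid J}

/-! ### Coordinate rings -/

/-- The ring `ℂ[ε, Δ^{(b)}_i]`, as a polynomial ring over `ℂ[ε]`. -/
abbrev GlobalRing (n : ℕ) : Type := MvPolynomial (ZMod n × Fin n) (Polynomial ℂ)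

/-- The ring `ℂ[Δ^{(b)}_i]`. -/
abbrev FiberRing (n : ℕ) : Type := MvPolynomial (ZMod n × Fin n) ℂ

/-- The family `x` of numbers `x^{(b)}_i` is a family of homogeneous coordinates of the point `U`
of the product of projective spaces. -/
def Represents {n : ℕ} (x : ZMod n × Fin n → ℂ) (U : ZMod n → Projectivization ℂ (W n)) : Prop :=
  ∀ b : ZMod n, ∃ h : (fun i : Fin n => x (b, i)) ≠ 0, Projectivization.mk ℂ _ h = U b

/-- Evaluation of an element of `ℂ[ε, Δ]` at a value of `ε` and values of the `Δ^{(b)}_i`. -/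
def evalAt {n : ℕ} (ε : ℂ) (x : ZMod n × Fin n → ℂ) : GlobalRing n →+* ℂ :=
  MvPolynomial.eval₂Hom (Polynomial.evalRingHom ε) x

/-- Specialization of the parameter to the number `ε`. -/
def specialize {n : ℕ} (ε : ℂ) : GlobalRing n →+* FiberRing n :=
  MvPolynomial.map (Polynomial.evalRingHom ε)

/-- The (radical, multihomogeneous) ideal of a subset of `𝔸¹ × ∏_b ℙ(W)`: the polynomials that
vanish at all homogeneous coordinates of all its points. -/
def globalVanishingIdeal {n : ℕ} (Z : Set (ℂ × (ZMod n → Projectivization ℂ (W n)))) :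
    Ideal (GlobalRing n) :=
  ⨅ p ∈ Z, ⨅ x : ZMod n × Fin n → ℂ, ⨅ _ : Represents x p.2, RingHom.ker (evalAt p.1 x)

/-- The (radical, multihomogeneous) ideal of a subset of `∏_b ℙ(W)`. -/
def fiberVanishingIdeal {n : ℕ} (Z : Set (ZMod n → Projectivization ℂ (W n))) :
    Ideal (FiberRing n) :=
  ⨅ U ∈ Z, ⨅ x : ZMod n × Fin n → ℂ, ⨅ _ : Represents x U,
    RingHom.ker (MvPolynomial.eval x : FiberRing n →+* ℂ)

/-- The ideal of the global positroid variety. -/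
abbrev globalPluckerIdeal {n : ℕ} (J : ZMod n → Fin n) : Ideal (GlobalRing n) :=
  globalVanishingIdeal (globalPositroid J)

/-- The ideal of the fiber over `ε`. -/
abbrev fiberPluckerIdeal {n : ℕ} (J : ZMod n → Fin n) (ε : ℂ) : Ideal (FiberRing n) :=
  fiberVanishingIdeal (positroidFiber J ε)

/-- The global Plücker algebra, a `ℂ[ε]`-algebra. -/
abbrev GlobalPluckerAlgebra {n : ℕ} (J : ZMod n → Fin n) : Type :=
  GlobalRing n ⧸ globalPluckerIdeal J

/-- The variable `Δ^{(b)}_i` has multidegree the `b`-th unit vector. -/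
def degreeWeight {n : ℕ} (p : ZMod n × Fin n) : ZMod n → ℕ := Pi.single p.1 1

/-- The component of multidegree `m` of the global Plücker algebra: the classes of the
polynomials that are multihomogeneous of multidegree `m` in the variables `Δ^{(b)}_i`. -/
def pluckerComponent {n : ℕ} (J : ZMod n → Fin n) (m : ZMod n → ℕ) :
    Submodule (Polynomial ℂ) (GlobalPluckerAlgebra J) :=
  (MvPolynomial.weightedHomogeneousSubmodule (Polynomial ℂ) degreeWeight m).map
    (Ideal.Quotient.mkₐ (Polynomial ℂ) (globalPluckerIdeal J)).toLinearMap

/-- The class in the global Plücker algebra of the monomial `∏ (Δ^{(b)}_i) ^ e (b, i)`. -/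
def pluckerMonomial {n : ℕ} (J : ZMod n → Fin n) (e : ZMod n × Fin n →₀ ℕ) :
    GlobalPluckerAlgebra J :=
  Ideal.Quotient.mk (globalPluckerIdeal J) (MvPolynomial.monomial e 1)

/-- The monomial with exponents `e` is `J`-admissible. In terms of the indices in `{1, …, n}`:
`b + i - 1 ∈ L(J)` for each variable `Δ^{(b)}_i` that occurs; and if `Δ^{(b)}_i` occurs, `s` is in
`{1, …, n - 1}` and `i > s`, then `r ≤ i - s` for each `Δ^{(b+s)}_r` that occurs. -/
def IsAdmissible {n : ℕ} (J : ZMod n → Fin n) (e : ZMod n × Fin n →₀ ℕ) : Prop :=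
  (∀ (b : ZMod n) (i : Fin n), e (b, i) ≠ 0 → b + ((i : ℕ) : ZMod n) ∈ L J) ∧
  ∀ (b : ZMod n) (i : Fin n) (s : ℕ), 1 ≤ s → s ≤ n - 1 → e (b, i) ≠ 0 → s < (i : ℕ) + 1 →
    ∀ r : Fin n, e (b + (s : ZMod n), r) ≠ 0 → (r : ℕ) + 1 ≤ (i : ℕ) + 1 - s

/-! ### The explicit relations -/

/-- The cyclic shift `i - c` of an index: with `c` represented by a number in `{0, …, n - 1}`, it is
`i - c` if `i > c`, and `i - c + n` if `i ≤ c`. The shift `j + c` is `j - (-c)`. -/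
def shiftBy {n : ℕ} [NeZero n] (c : ZMod n) (i : Fin n) : Fin n :=
  if h : c.val < (i : ℕ) + 1 then ⟨(i : ℕ) - c.val, by have := i.isLt; omega⟩
  else ⟨(i : ℕ) + n - c.val, by have := i.isLt; have := c.val_lt; omega⟩

/-- `d_c(i)`: it is `1` if `i ≤ c` and `0` otherwise, with `c` represented in `{0, …, n - 1}`. -/
def wrapCount {n : ℕ} (c : ZMod n) (i : Fin n) : ℕ :=
  if (i : ℕ) + 1 ≤ c.val then 1 else 0

/-- The variable `Δ^{(b)}_i` of `ℂ[ε, Δ]`. -/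
def Delta {n : ℕ} (b : ZMod n) (i : Fin n) : GlobalRing n := MvPolynomial.X (b, i)

/-- The parameter `ε` in `ℂ[ε, Δ]`. -/
def eps {n : ℕ} : GlobalRing n := MvPolynomial.C Polynomial.X

/-- The explicit relations, for `k = 1`: the Schubert relations, and the two families of quadratic
relations that link two vertices. (The Grassmannian `Gr_{1,n}` is all of `ℙ(W)`, so there are no
Plücker relations.) -/
def definingRelations {n : ℕ} [NeZero n] (J : ZMod n → Fin n) : Set (GlobalRing n) :=
  {F | ∃ (a : ZMod n) (i : Fin n), ¬ J a ≤ i ∧ F = Delta a i} ∪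
  {F | ∃ (a c : ZMod n) (i j : Fin n), wrapCount c i ≤ wrapCount c (shiftBy (-c) j) ∧
    F = Delta a i * Delta (a + c) j -
      eps ^ (wrapCount c (shiftBy (-c) j) - wrapCount c i) *
        (Delta a (shiftBy (-c) j) * Delta (a + c) (shiftBy c i))} ∪
  {F | ∃ (a c : ZMod n) (i j : Fin n), wrapCount c (shiftBy (-c) j) < wrapCount c i ∧
    F = eps ^ (wrapCount c i - wrapCount c (shiftBy (-c) j)) *
        (Delta a i * Delta (a + c) j) -
      Delta a (shiftBy (-c) j) * Delta (a + c) (shiftBy c i)}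

/-- The ideal generated by the explicit relations. -/
def relationIdeal {n : ℕ} [NeZero n] (J : ZMod n → Fin n) : Ideal (GlobalRing n) :=
  Ideal.span (definingRelations J)

/-- The ideal generated by the specializations of the explicit relations at `ε`. -/
def fiberRelationIdeal {n : ℕ} [NeZero n] (J : ZMod n → Fin n) (ε : ℂ) : Ideal (FiberRing n) :=
  Ideal.span (specialize ε '' definingRelations J)

/-! ### Reduced scheme structures

The product `𝔸¹ × ∏_b ℙ(W)` is covered by the affine charts `Δ^{(b)}_{σ(b)} ≠ 0 (all b)`, one for
each `σ`, with coordinate ring `ℂ[ε, Δ] / (Δ^{(b)}_{σ(b)} - 1)_b`. A multihomogeneous ideal `I`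
defines the closed subscheme that is cut out on this chart by the image of `I`. -/

/-- The closed subscheme of `𝔸¹ × ∏_b ℙ(W)` defined by the multihomogeneous ideal `I` is the subset
`Z` with its reduced scheme structure: on each chart, the ideal of the subscheme consists of all
functions that vanish on the part of `Z` in the chart. -/
def DefinesReducedFamily {n : ℕ} (I : Ideal (GlobalRing n))
    (Z : Set (ℂ × (ZMod n → Projectivization ℂ (W n)))) : Prop :=
  ∀ (σ : ZMod n → Fin n) (F : GlobalRing n),
    F ∈ I ⊔ Ideal.span (Set.range fun b : ZMod n => (MvPolynomial.X (b, σ b) - 1 : GlobalRing n)) ↔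
      ∀ p ∈ Z, ∀ x : ZMod n × Fin n → ℂ, Represents x p.2 → (∀ b, x (b, σ b) = 1) →
        evalAt p.1 x F = 0

/-- The closed subscheme of `∏_b ℙ(W)` defined by the multihomogeneous ideal `I` is the subset `Z`
with its reduced scheme structure. -/
def DefinesReducedFiber {n : ℕ} (I : Ideal (FiberRing n))
    (Z : Set (ZMod n → Projectivization ℂ (W n))) : Prop :=
  ∀ (σ : ZMod n → Fin n) (F : FiberRing n),
    F ∈ I ⊔ Ideal.span (Set.range fun b : ZMod n => (MvPolynomial.X (b, σ b) - 1 : FiberRing n)) ↔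
      ∀ U ∈ Z, ∀ x : ZMod n × Fin n → ℂ, Represents x U → (∀ b, x (b, σ b) = 1) →
        MvPolynomial.eval x F = 0

end

end GlobalPositroid

open GlobalPositroid

open GlobalPositroid

namespace GlobalPositroid

/-! A variable is an arc from its vertex to its position, and the quadratic relations say that two
arcs may exchange their positions at the cost of a power of `ε`. The multiset of all vertices and
positions of a monomial (`endpoints`) is thus preserved, and the proof compares monomials with equal
endpoints.

Spanning: among all arcs from an available vertex to an available position, take a shortest one. If
the monomial does not contain it, one exchange creates it; the rest is treated by induction on the
degree (`AllowsExchange.exists_isAdmissible`). The nesting condition in admissibility forces a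
monomial to contain such an innermost arc, so an admissible monomial is determined by its endpoints
(`IsAdmissible.eq_of_endpoints_eq`).

Independence: each `t ∈ L J` gives a torus of points in the fiber over `ε`, on which every monomial
becomes a scalar times the monomial in new variables `z` with exponent `endpoints`. The scalar is
`1` if all positions lie in `L J` and no arc passes strictly beyond `t`, and every admissible
monomial admits such a `t` (`IsAdmissible.exists_uncovered`). Reading off one coefficient for each
monomial proves independence in every fiber, including `ε = 0` (`eq_zero_of_mem_fiberPluckerIdeal`),
and hence over `ℂ[ε]`.

Relations: a variable with position outside `L J` vanishes on the variety but need not lie in the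
relation ideal. Multiplied by a variable whose vertex is that position, it does, by an exchange and
a Schubert relation (`AllowsExchange.monomial_mem`). When all multidegrees outside `L J` are
positive, reduction to admissible monomials therefore uses only the explicit relations, and
independence gives equality of the ideals. On a chart, homogenization to large multidegree
(`exists_homogenization`) reduces to this case. -/

/-! ### Vertices and positions

The variable `Δ^{(b)}_i` is regarded as an arc on the cycle `ℤ_n`, which leads from its vertex `b` to
its position `b + i - 1`. -/

/-- The indicator of the vertex and of the position of a variable. -/
noncomputable def endpointWeight {n : ℕ} (v : ZMod n × Fin n) : ZMod n ⊕ ZMod n →₀ ℕ :=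
  Finsupp.single (Sum.inl v.1) 1 + Finsupp.single (Sum.inr (v.1 + ((v.2 : ℕ) : ZMod n))) 1

/-- The multiplicities of the vertices and of the positions of a monomial. -/
noncomputable abbrev endpoints {n : ℕ} (e : ZMod n × Fin n →₀ ℕ) : ZMod n ⊕ ZMod n →₀ ℕ :=
  Finsupp.weight endpointWeight e

theorem natCast_fin_injective {n : ℕ} {i j : Fin n} (h : ((i : ℕ) : ZMod n) = ((j : ℕ) : ZMod n)) :
    i = j := by
  rw [ZMod.natCast_eq_natCast_iff', Nat.mod_eq_of_lt i.isLt, Nat.mod_eq_of_lt j.isLt] at h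
  exact Fin.ext h

theorem val_natCast_fin {n : ℕ} (i : Fin n) : ((i : ℕ) : ZMod n).val = i :=
  ZMod.val_natCast_of_lt i.isLt

theorem exists_fin_natCast {n : ℕ} [NeZero n] (c : ZMod n) : ∃ i : Fin n, ((i : ℕ) : ZMod n) = c :=
  ⟨⟨c.val, c.val_lt⟩, ZMod.natCast_zmod_val c⟩

section Basic

variable {n : ℕ} {J : ZMod n → Fin n} {e : ZMod n × Fin n →₀ ℕ}

theorem isAdmissible_zero (J : ZMod n → Fin n) : IsAdmissible J 0 := by
  constructor <;> simp

theorem IsAdmissible.mono {e' : ZMod n × Fin n →₀ ℕ} (h : IsAdmissible J e) (hle : e' ≤ e) :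
    IsAdmissible J e' := by
  have key : ∀ v, e' v ≠ 0 → e v ≠ 0 := fun v hv h0 => hv (Nat.le_zero.mp (h0 ▸ hle v))
  exact ⟨fun b i hb => h.1 b i (key _ hb),
    fun b i s h1 h2 hb hs r hr => h.2 b i s h1 h2 (key _ hb) hs r (key _ hr)⟩

theorem eq_add_of_position_eq {b b' : ZMod n} {i i' : Fin n} (hi : i ≤ i')
    (hp : b' + ((i' : ℕ) : ZMod n) = b + ((i : ℕ) : ZMod n)) :
    b' + (((i' : ℕ) - (i : ℕ) : ℕ) : ZMod n) = b := by
  rw [Nat.cast_sub hi, ← add_sub_assoc, hp, add_sub_cancel_right]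

theorem sub_single_add_single {v : ZMod n × Fin n} (h : e v ≠ 0) :
    e - Finsupp.single v 1 + Finsupp.single v 1 = e :=
  tsub_add_cancel_of_le (Finsupp.single_le_iff.mpr (Nat.one_le_iff_ne_zero.mpr h))

end Basic

/-! ### Endpoint multiplicities and innermost arcs. -/

section Endpoints

variable {n : ℕ} [NeZero n] {e : ZMod n × Fin n →₀ ℕ}

theorem endpoints_inl_ne_zero {b : ZMod n} :
    endpoints e (Sum.inl b) ≠ 0 ↔ ∃ i, e (b, i) ≠ 0 := by
  rw [endpoints, Finsupp.weight_eq_sum, Finsupp.finsetSum_apply, Ne, Finset.sum_eq_zero_iff]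
  simp [endpointWeight, Finsupp.single_apply]

theorem endpoints_inr_ne_zero {p : ZMod n} :
    endpoints e (Sum.inr p) ≠ 0 ↔
      ∃ (b : ZMod n) (i : Fin n), b + ((i : ℕ) : ZMod n) = p ∧ e (b, i) ≠ 0 := by
  rw [endpoints, Finsupp.weight_eq_sum, Finsupp.finsetSum_apply, Ne, Finset.sum_eq_zero_iff]
  simp only [Finset.mem_univ, endpointWeight, Finsupp.smul_apply, Finsupp.add_apply,
    Finsupp.single_apply, reduceCtorEq, if_false, zero_add, Sum.inr.injEq, smul_eq_mul,
    forall_true_left, Prod.forall, mul_eq_zero, not_forall, not_or]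
  simp [and_comm]

theorem weight_degreeWeight (e : ZMod n × Fin n →₀ ℕ) :
    Finsupp.weight degreeWeight e = fun b => endpoints e (Sum.inl b) := by
  ext b
  simp [endpoints, Finsupp.weight_eq_sum, endpointWeight, degreeWeight, Finsupp.single_apply,
    Pi.single_apply, eq_comm]

theorem weight_degreeWeight_eq {e e' : ZMod n × Fin n →₀ ℕ} (h : endpoints e = endpoints e') :
    Finsupp.weight degreeWeight e = Finsupp.weight degreeWeight e' := by
  simp [weight_degreeWeight, h]

/-- An arc of minimal length among all arcs that lead from a vertex to a position of `d`. -/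
structure IsInnermost (d : ZMod n ⊕ ZMod n →₀ ℕ) (b : ZMod n) (i : Fin n) : Prop where
  vertex : d (Sum.inl b) ≠ 0
  position : d (Sum.inr (b + ((i : ℕ) : ZMod n))) ≠ 0
  le : ∀ (b' : ZMod n) (i' : Fin n), d (Sum.inl b') ≠ 0 →
    d (Sum.inr (b' + ((i' : ℕ) : ZMod n))) ≠ 0 → i ≤ i'

theorem exists_isInnermost (he : e ≠ 0) : ∃ b i, IsInnermost (endpoints e) b i := by
  obtain ⟨⟨b, i⟩, hbi⟩ := Finsupp.ne_iff.mp he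
  obtain ⟨⟨b', i'⟩, h, hmin⟩ := Set.exists_min_image
    {v : ZMod n × Fin n | endpoints e (Sum.inl v.1) ≠ 0 ∧
      endpoints e (Sum.inr (v.1 + ((v.2 : ℕ) : ZMod n))) ≠ 0} Prod.snd (Set.toFinite _)
    ⟨(b, i), endpoints_inl_ne_zero.mpr ⟨i, hbi⟩, endpoints_inr_ne_zero.mpr ⟨b, i, rfl, hbi⟩⟩
  exact ⟨b', i', h.1, h.2, fun b'' i'' h₁ h₂ => hmin (b'', i'') ⟨h₁, h₂⟩⟩

variable {J : ZMod n → Fin n}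

/-- If the innermost arc does not occur in `e`, then `e` has a longer arc that leaves from `b` and a
longer arc that leads to `b + i`. -/
theorem IsInnermost.exists_arcs {b : ZMod n} {i : Fin n} (h : IsInnermost (endpoints e) b i)
    (hbi : e (b, i) = 0) :
    ∃ (j : Fin n) (b' : ZMod n) (i' : Fin n), e (b, j) ≠ 0 ∧ e (b', i') ≠ 0 ∧ i < j ∧ i < i' ∧
      b' + ((i' : ℕ) : ZMod n) = b + ((i : ℕ) : ZMod n) := by
  obtain ⟨j, hj⟩ := endpoints_inl_ne_zero.mp h.vertex
  obtain ⟨b', i', hp, hi'⟩ := endpoints_inr_ne_zero.mp h.position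
  have hij : i ≤ j := h.le b j h.vertex (endpoints_inr_ne_zero.mpr ⟨b, j, rfl, hj⟩)
  have hii' : i ≤ i' := h.le b' i' (endpoints_inl_ne_zero.mpr ⟨i', hi'⟩)
    (endpoints_inr_ne_zero.mpr ⟨b', i', rfl, hi'⟩)
  refine ⟨j, b', i', hj, hi', lt_of_le_of_ne hij ?_, lt_of_le_of_ne hii' ?_, hp⟩
  · rintro rfl
    exact hj hbi
  · rintro rfl
    rw [add_left_inj] at hp
    exact hi' (hp ▸ hbi)

/-- Otherwise a longer arc into the same position passes over `b`, from which another arc leaves and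
ends beyond that position. This crossing violates condition (b). -/
theorem IsAdmissible.innermost_ne_zero (he : IsAdmissible J e) {b : ZMod n} {i : Fin n}
    (h : IsInnermost (endpoints e) b i) : e (b, i) ≠ 0 := by
  intro hbi
  obtain ⟨j, b', i', hj, hi', hij, hii', hp⟩ := h.exists_arcs hbi
  have hb := eq_add_of_position_eq hii'.le hp
  have := he.2 b' i' (i' - i : ℕ) (by omega) (by omega) hi' (by omega) j (by rwa [hb])
  omega

/-- If an arc passes over the vertex of another one, the remaining piece of the former again joins a
vertex to a position, so it is no shorter than the new arc. The new arc thus ends no later than any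
arc that passes over `b`, and passes over no vertex itself. -/
theorem IsAdmissible.add_innermost (he : IsAdmissible J e) {b : ZMod n} {i : Fin n}
    (hL : b + ((i : ℕ) : ZMod n) ∈ L J)
    (h : IsInnermost (endpoints (e + Finsupp.single (b, i) 1)) b i) :
    IsAdmissible J (e + Finsupp.single (b, i) 1) := by
  have hin : ∀ (b' : ZMod n) (i' : Fin n),
      (e + Finsupp.single (b, i) 1 : ZMod n × Fin n →₀ ℕ) (b', i') ≠ 0 →
      e (b', i') ≠ 0 ∨ b' = b ∧ i' = i := by
    intro b' i' h'
    by_contra! hcon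
    refine h' ?_
    rw [Finsupp.add_apply, hcon.1, Finsupp.single_eq_of_ne, add_zero]
    intro hvi
    exact hcon.2 (congrArg Prod.fst hvi) (congrArg Prod.snd hvi)
  refine ⟨fun b' i' h' => ?_, fun b₁ i₁ s hs1 hsn h₁ hs r h₂ => ?_⟩
  · rcases hin b' i' h' with h' | ⟨rfl, rfl⟩
    exacts [he.1 b' i' h', hL]
  · have hv₁ := endpoints_inl_ne_zero.mpr ⟨i₁, h₁⟩
    have hp₁ := endpoints_inr_ne_zero.mpr ⟨b₁, i₁, rfl, h₁⟩
    have hv₂ := endpoints_inl_ne_zero.mpr ⟨r, h₂⟩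
    have hle : (i : ℕ) ≤ i₁ - s := h.le (b₁ + s) ⟨i₁ - s, by omega⟩ hv₂ (by
      convert hp₁ using 3
      rw [add_assoc, ← Nat.cast_add]
      congr 2
      simp only
      omega)
    rcases hin _ _ h₁ with h₁' | ⟨-, rfl⟩
    · rcases hin _ _ h₂ with h₂' | ⟨-, rfl⟩
      · exact he.2 b₁ i₁ s hs1 hsn h₁' hs r h₂'
      · omega
    · omega

/-- An admissible monomial is determined by the multiplicities of its vertices and positions. -/
theorem IsAdmissible.eq_of_endpoints_eq {e e' : ZMod n × Fin n →₀ ℕ} (he : IsAdmissible J e)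
    (he' : IsAdmissible J e') (h : endpoints e = endpoints e') : e = e' := by
  induction hN : e.degree generalizing e e' with
  | zero =>
    obtain rfl : e = 0 := (Finsupp.degree_eq_zero_iff e).mp hN
    by_contra hne
    obtain ⟨b, i, hbi⟩ := exists_isInnermost (Ne.symm hne)
    exact hbi.vertex (by rw [← h]; simp)
  | succ N ih =>
    -- Being innermost depends only on the endpoints, so both monomials contain this arc and it can
    -- be cancelled.
    obtain ⟨b, i, hbi⟩ := exists_isInnermost (e := e) (by rintro rfl; simp at hN)
    have h₁ := sub_single_add_single (he.innermost_ne_zero hbi)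
    have h₂ := sub_single_add_single (he'.innermost_ne_zero (h ▸ hbi))
    rw [← h₁, ← h₂]
    congr 1
    refine ih (he.mono tsub_le_self) (he'.mono tsub_le_self) ?_ ?_
    · rw [← h₁, ← h₂, endpoints, endpoints, map_add, map_add] at h
      exact add_right_cancel h
    · rw [← h₁, map_add, Finsupp.degree_single] at hN
      omega

/-- The arcs of an admissible monomial do not cover all of `L(J)`. -/
theorem IsAdmissible.exists_uncovered (he : IsAdmissible J e) (hL : (L J).Nonempty) :
    ∃ t ∈ L J, ∀ (b : ZMod n) (i : Fin n), e (b, i) ≠ 0 → (i : ℕ) ≤ (t - b).val := by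
  by_cases h0 : e = 0
  · obtain ⟨t, ht⟩ := hL
    exact ⟨t, ht, fun b i h => absurd (by simp [h0]) h⟩
  obtain ⟨⟨b, i⟩, hbi, hmax⟩ := Finset.exists_max_image e.support Prod.snd
    (Finsupp.support_nonempty_iff.mpr h0)
  rw [Finsupp.mem_support_iff] at hbi
  -- The end of a longest arc serves as `t`: an arc running beyond it would be no longer than the
  -- longest arc, hence would start inside it and cross it.
  refine ⟨_, he.1 b i hbi, fun b' j hj => ?_⟩
  by_contra! hlt
  have hji : j ≤ i := hmax (b', j) (Finsupp.mem_support_iff.mpr hj)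
  set d := (b + ((i : ℕ) : ZMod n) - b').val with hd
  have hdb : b' + (d : ZMod n) = b + ((i : ℕ) : ZMod n) := by
    rw [hd, ZMod.natCast_zmod_val, add_sub_cancel]
  have hb : b + (((i : ℕ) - d : ℕ) : ZMod n) = b' :=
    eq_add_of_position_eq (i := ⟨d, by omega⟩) (by rw [Fin.le_def]; simp only; omega) hdb.symm
  have := he.2 b i (i - d : ℕ) (by omega) (by omega) hbi (by omega) j (by rwa [hb])
  omega

end Endpoints

/-! ### Reduction to admissible monomials -/

section Reduction

open MvPolynomial

variable {n : ℕ} [NeZero n] {R : Type*} [CommRing R] {J : ZMod n → Fin n}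

/-- The ideal `K` allows to exchange the positions of two variables up to a scalar, if the vertex of
the second one is passed by the arc of the first one. -/
def AllowsExchange (K : Ideal (MvPolynomial (ZMod n × Fin n) R)) : Prop :=
  ∀ (b b' : ZMod n) (i j i' j' : Fin n), i' ≤ i →
    b' + ((i' : ℕ) : ZMod n) = b + ((i : ℕ) : ZMod n) →
    b + ((j' : ℕ) : ZMod n) = b' + ((j : ℕ) : ZMod n) →
    ∃ r : R, X (b, i) * X (b', j) - C r * (X (b, j') * X (b', i')) ∈ K

variable {K : Ideal (MvPolynomial (ZMod n × Fin n) R)}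

/-- One exchange is enough: the arc that leaves from `b` and the arc that arrives at `b + i` trade
their positions. -/
theorem AllowsExchange.exists_innermost (hK : AllowsExchange K) {e : ZMod n × Fin n →₀ ℕ}
    {b : ZMod n} {i : Fin n} (h : IsInnermost (endpoints e) b i) :
    ∃ (e' : ZMod n × Fin n →₀ ℕ) (r : R), endpoints (e' + Finsupp.single (b, i) 1) = endpoints e ∧
      e'.degree + 1 = e.degree ∧
      monomial e 1 - C r * monomial (e' + Finsupp.single (b, i) 1) 1 ∈ K := by
  by_cases hbi : e (b, i) = 0
  swap
  · refine ⟨e - Finsupp.single (b, i) 1, 1, ?_, ?_, ?_⟩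
    · rw [sub_single_add_single hbi]
    · conv_rhs => rw [← sub_single_add_single hbi, map_add, Finsupp.degree_single]
    · simp [sub_single_add_single hbi]
  obtain ⟨j, b', i', hj, hi', hij, hii', hp⟩ := h.exists_arcs hbi
  obtain ⟨j', hj'⟩ := exists_fin_natCast (b + ((j : ℕ) : ZMod n) - b')
  have hj'' : b' + ((j' : ℕ) : ZMod n) = b + ((j : ℕ) : ZMod n) := by
    rw [hj', add_sub_cancel]
  -- The longer arc from `b'` passes over `b`, so the exchange is allowed in this direction, without
  -- a power of `ε` in front of the original product.
  obtain ⟨r, hr⟩ := hK b' b i' j i j' hii'.le hp.symm hj''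
  have hne : (b, j) ≠ (b', i') := by
    rintro heq
    obtain ⟨rfl, rfl⟩ := Prod.mk.inj heq
    exact hij.ne' (natCast_fin_injective (add_left_cancel hp))
  have hi'' : (e - Finsupp.single (b, j) 1 : ZMod n × Fin n →₀ ℕ) (b', i') ≠ 0 := by
    rwa [Finsupp.tsub_apply, Finsupp.single_eq_of_ne hne.symm, tsub_zero]
  set e₀ := e - Finsupp.single (b, j) 1 - Finsupp.single (b', i') 1 with he₀
  have he : e₀ + Finsupp.single (b', i') 1 + Finsupp.single (b, j) 1 = e := by
    rw [he₀, sub_single_add_single hi'', sub_single_add_single hj]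
  refine ⟨e₀ + Finsupp.single (b', j') 1, r, ?_, ?_, ?_⟩
  · rw [← he]
    simp only [endpoints, map_add, add_assoc]
    congr 1
    simp only [Finsupp.weight_single, one_smul, endpointWeight, hj'', hp]
    abel
  · rw [← he]
    simp [map_add, Finsupp.degree_single]
  · rw [← he]
    simp only [monomial_add_single, pow_one]
    convert K.mul_mem_left (monomial e₀ 1) hr using 1
    ring

/-- A monomial with positions in `L(J)` is a multiple of the admissible monomial with the same
vertices and positions. -/
theorem AllowsExchange.exists_isAdmissible (hK : AllowsExchange K) (e : ZMod n × Fin n →₀ ℕ)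
    (he : ∀ (b : ZMod n) (i : Fin n), e (b, i) ≠ 0 → b + ((i : ℕ) : ZMod n) ∈ L J) :
    ∃ (e' : ZMod n × Fin n →₀ ℕ) (r : R), IsAdmissible J e' ∧ endpoints e' = endpoints e ∧
      monomial e 1 - C r * monomial e' 1 ∈ K := by
  induction hN : e.degree generalizing e with
  | zero =>
    obtain rfl : e = 0 := (Finsupp.degree_eq_zero_iff e).mp hN
    exact ⟨0, 1, isAdmissible_zero J, rfl, by simp⟩
  | succ N ih =>
    obtain ⟨b, i, hbi⟩ := exists_isInnermost (e := e) (by rintro rfl; simp at hN)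
    obtain ⟨e₁, r₁, hend, hdeg, h₁⟩ := hK.exists_innermost hbi
    have hL : ∀ p, endpoints e (Sum.inr p) ≠ 0 → p ∈ L J := by
      intro p hp
      obtain ⟨b, i, rfl, h⟩ := endpoints_inr_ne_zero.mp hp
      exact he b i h
    obtain ⟨e₂, r₂, hadm, hend₂, h₂⟩ := ih e₁ (fun b' i' h' => hL _ (by
      rw [← hend]
      exact endpoints_inr_ne_zero.mpr ⟨b', i', rfl, by
        rw [Finsupp.add_apply]
        omega⟩)) (by omega)
    have hend' : endpoints (e₂ + Finsupp.single (b, i) 1) = endpoints e := by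
      rw [← hend, endpoints, endpoints, map_add, map_add]
      exact congrArg (· + _) hend₂
    refine ⟨e₂ + Finsupp.single (b, i) 1, r₁ * r₂,
      hadm.add_innermost (hL _ hbi.position) (by rwa [hend']), hend', ?_⟩
    simp only [monomial_add_single, pow_one, C_mul] at h₁ ⊢
    convert K.add_mem h₁ (K.mul_mem_left (C r₁ * X (b, i)) h₂) using 1
    ring

/-- Retaining the endpoints keeps track of the multidegree, so this serves for the whole algebra and
for each graded component. -/
theorem AllowsExchange.restrictSupport_le (hK : AllowsExchange K)
    (S : Set (ZMod n × Fin n →₀ ℕ))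
    (hS : ∀ e ∈ S, ∀ (b : ZMod n) (i : Fin n), e (b, i) ≠ 0 → b + ((i : ℕ) : ZMod n) ∉ L J →
      (monomial e 1 : MvPolynomial (ZMod n × Fin n) R) ∈ K) :
    restrictSupport R S ≤
      restrictSupport R {e | IsAdmissible J e ∧ ∃ e' ∈ S, endpoints e = endpoints e'} ⊔
        K.restrictScalars R := by
  rw [restrictSupport_eq_span, Submodule.span_le]
  rintro _ ⟨e, he, rfl⟩
  by_cases h : ∀ (b : ZMod n) (i : Fin n), e (b, i) ≠ 0 → b + ((i : ℕ) : ZMod n) ∈ L J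
  · obtain ⟨e', r, hadm, hend, hmem⟩ := hK.exists_isAdmissible e h
    rw [SetLike.mem_coe]
    beta_reduce
    rw [← add_sub_cancel (C r * monomial e' 1) (monomial e (1 : R))]
    refine Submodule.add_mem_sup ?_ hmem
    rw [C_mul_monomial, monomial_mem_restrictSupport]
    exact Or.inl ⟨hadm, e, he, hend⟩
  · push Not at h
    obtain ⟨b, i, hbi, hL⟩ := h
    exact Submodule.mem_sup_right (hS e he b i hbi hL)

end Reduction

/-! ### Homogeneous coordinates of the points -/

section Coordinates

variable {n : ℕ} {ε : ℂ} {x : ZMod n × Fin n → ℂ}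

theorem mem_span_w_iff {j : Fin n} {v : W n} :
    v ∈ Submodule.span ℂ {v | ∃ i : Fin n, j ≤ i ∧ v = w i} ↔ ∀ i < j, v i = 0 := by
  constructor
  · intro hv i hij
    induction hv using Submodule.span_induction with
    | mem v hv =>
      obtain ⟨k, hk, rfl⟩ := hv
      exact Pi.single_eq_of_ne (hij.trans_le hk).ne _
    | zero => rfl
    | add u v _ _ hu hv => rw [Pi.add_apply, hu, hv, add_zero]
    | smul c v _ hv => rw [Pi.smul_apply, hv, smul_zero]
  · intro hv
    rw [← (Pi.basisFun ℂ (Fin n)).sum_repr v]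
    refine Submodule.sum_mem _ fun i _ => ?_
    rw [Pi.basisFun_repr, Pi.basisFun_apply]
    by_cases hij : i < j
    · rw [hv i hij, zero_smul]
      exact Submodule.zero_mem _
    · exact Submodule.smul_mem _ _ (Submodule.subset_span ⟨i, not_lt.mp hij, rfl⟩)

theorem Represents.exists_ne_zero {U : ZMod n → Projectivization ℂ (W n)}
    (hx : Represents x U) (b : ZMod n) : ∃ i, x (b, i) ≠ 0 := by
  obtain ⟨h, -⟩ := hx b
  exact Function.ne_iff.mp h

theorem exists_represents (hx : ∀ b : ZMod n, ∃ i, x (b, i) ≠ 0) : ∃ U, Represents x U :=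
  ⟨fun b => Projectivization.mk ℂ (fun i => x (b, i)) (Function.ne_iff.mpr (hx b)),
    fun b => ⟨Function.ne_iff.mpr (hx b), rfl⟩⟩

theorem evalAt_eq (F : GlobalRing n) :
    evalAt ε x F = MvPolynomial.eval x (specialize ε F) := by
  rw [specialize, MvPolynomial.eval_map]
  rfl

theorem wrapCount_eq_zero_or_one (c : ZMod n) (i : Fin n) :
    wrapCount c i = 0 ∨ wrapCount c i = 1 := by
  unfold wrapCount
  split_ifs <;> simp

@[simp] theorem specialize_Delta (b : ZMod n) (i : Fin n) :
    specialize ε (Delta b i) = MvPolynomial.X (b, i) := by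
  simp [specialize, Delta]

@[simp] theorem specialize_eps : specialize ε (eps : GlobalRing n) = MvPolynomial.C ε := by
  simp [specialize, eps]

end Coordinates

/-! ### Equations of the points, and transport around the cycle. -/

section Points

variable {n : ℕ} [NeZero n] {J : ZMod n → Fin n} {ε : ℂ} {x : ZMod n × Fin n → ℂ}

theorem natCast_shiftBy (c : ZMod n) (i : Fin n) :
    ((shiftBy c i : ℕ) : ZMod n) = ((i : ℕ) : ZMod n) - c := by
  have hc := c.val_lt
  unfold shiftBy
  split_ifs with h
  · simp only
    rw [Nat.cast_sub (by omega), ZMod.natCast_zmod_val]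
  · simp only
    rw [Nat.cast_sub (by omega), ZMod.natCast_zmod_val, Nat.cast_add, ZMod.natCast_self, add_zero]

theorem shiftBy_eq {c : ZMod n} {i j : Fin n} (h : ((i : ℕ) : ZMod n) - c = ((j : ℕ) : ZMod n)) :
    shiftBy c i = j :=
  natCast_fin_injective (by rw [natCast_shiftBy, h])

theorem shiftBy_shiftBy_neg (c : ZMod n) (i : Fin n) : shiftBy c (shiftBy (-c) i) = i :=
  shiftBy_eq (by rw [natCast_shiftBy]; ring)

/-- The congruence modulo `n` covers the shift and the wrap-around at once. It says that positions
are preserved, `b + i = (b + 1) + k`, so the maps are diagonal in the coordinates indexed by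
position. -/
theorem quiverMap_apply (ε : ℂ) (v : W n) {i k : Fin n}
    (h : ((i : ℕ) : ZMod n) = ((k : ℕ) : ZMod n) + 1) :
    quiverMap ε v k = (if (i : ℕ) = 0 then ε else 1) * v i := by
  have hk : ∀ i' : Fin n, i' ≠ i → ((i' : ℕ) : ZMod n) - 1 ≠ ((k : ℕ) : ZMod n) := by
    intro i' hi' heq
    exact hi' (natCast_fin_injective (by rw [h, ← heq, sub_add_cancel]))
  have hpos : 0 < n := Nat.pos_of_ne_zero (NeZero.ne n)
  rw [quiverMap, Module.Basis.constr_apply_fintype, Finset.sum_apply,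
    Finset.sum_eq_single i]
  · simp only [Pi.basisFun_equivFun, LinearEquiv.refl_apply, Pi.smul_apply, smul_eq_mul]
    split_ifs with h0
    · have : k = ⟨n - 1, by omega⟩ := natCast_fin_injective (by
        simp only
        rw [Nat.cast_sub hpos, ZMod.natCast_self, zero_sub, Nat.cast_one, eq_neg_iff_add_eq_zero,
          ← h, h0, Nat.cast_zero])
      simp [w, ← this, mul_comm]
    · have : k = ⟨i - 1, by omega⟩ := natCast_fin_injective (by
        simp only
        rw [Nat.cast_sub (by omega), h, Nat.cast_one, add_sub_cancel_right])
      simp [w, ← this]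
  · intro i' _ hi'
    have hk' := hk i' hi'
    simp only [Pi.basisFun_equivFun, LinearEquiv.refl_apply, Pi.smul_apply, smul_eq_mul]
    split_ifs with h0
    · rw [Pi.smul_apply, w, Pi.single_eq_of_ne, smul_zero, mul_zero]
      rintro rfl
      refine hk' ?_
      simp only
      rw [Nat.cast_sub hpos, ZMod.natCast_self, h0]
      simp
    · rw [w, Pi.single_eq_of_ne, mul_zero]
      rintro rfl
      refine hk' ?_
      simp only
      rw [Nat.cast_sub (by omega), Nat.cast_one]
  · simp

/-- The coordinate with vertex `b` and position `p`. -/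
def coord (x : ZMod n × Fin n → ℂ) (b p : ZMod n) : ℂ := x (b, ⟨(p - b).val, (p - b).val_lt⟩)

theorem coord_eq {b p : ZMod n} {i : Fin n} (h : b + ((i : ℕ) : ZMod n) = p) :
    coord x b p = x (b, i) := by
  unfold coord
  congr 2
  exact natCast_fin_injective (by rw [ZMod.natCast_zmod_val, ← h, add_sub_cancel_left])

/-- The equations for homogeneous coordinates of the points of the fiber over `ε`. -/
structure IsPoint (J : ZMod n → Fin n) (ε : ℂ) (x : ZMod n × Fin n → ℂ) : Prop where
  step : ∀ b : ZMod n, ∃ ν : ℂ, ∀ p : ZMod n,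
    (if p = b then ε else 1) * coord x b p = ν * coord x (b + 1) p
  schubert : ∀ (b : ZMod n) (i : Fin n), i < J b → x (b, i) = 0

theorem Represents.mem_positroidFiber_iff {U : ZMod n → Projectivization ℂ (W n)}
    (hx : Represents x U) : U ∈ positroidFiber J ε ↔ IsPoint J ε x := by
  have hU : ∀ b, (U b).submodule = Submodule.span ℂ {fun i => x (b, i)} := by
    intro b
    obtain ⟨h, hb⟩ := hx b
    rw [← hb, Projectivization.submodule_mk]
  have h₁ : (ε, U) ∈ globalGrassmannian n ↔ ∀ b : ZMod n, ∃ ν : ℂ, ∀ p : ZMod n,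
      (if p = b then ε else 1) * coord x b p = ν * coord x (b + 1) p := by
    refine forall_congr' fun b => ?_
    simp only [hU]
    rw [Submodule.map_span, Set.image_singleton, Submodule.span_singleton_le_iff_mem,
      Submodule.mem_span_singleton]
    refine exists_congr fun ν => ?_
    have key : ∀ p : ZMod n, ∀ k : Fin n, b + 1 + ((k : ℕ) : ZMod n) = p →
        (if p = b then ε else 1) * coord x b p = quiverMap ε (fun i => x (b, i)) k := by
      intro p k hk
      obtain ⟨i, hi⟩ := exists_fin_natCast (p - b)
      rw [quiverMap_apply (i := i), coord_eq (i := i)]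
      · congr 1
        refine if_congr ?_ rfl rfl
        rw [← sub_eq_zero, ← hi]
        constructor
        · intro h
          exact (congrArg Fin.val (natCast_fin_injective (j := ⟨0, i.pos⟩) (by simpa using h)))
        · intro h
          rw [h, Nat.cast_zero]
      · rw [hi, add_sub_cancel]
      · rw [hi, ← hk]
        ring
    constructor
    · intro h p
      obtain ⟨k, hk⟩ := exists_fin_natCast (p - (b + 1))
      have hk' : b + 1 + ((k : ℕ) : ZMod n) = p := by rw [hk, add_sub_cancel]
      rw [key p k hk', ← h, coord_eq hk']
      rfl
    · intro h
      ext k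
      rw [← key _ k rfl, h, coord_eq rfl]
      rfl
  have h₂ : (∀ b, U b ∈ oppositeSchubert (J b)) ↔ ∀ (b : ZMod n) (i : Fin n), i < J b →
      x (b, i) = 0 := by
    refine forall_congr' fun b => ?_
    rw [oppositeSchubert, Set.mem_ofPred_eq, hU, Submodule.span_singleton_le_iff_mem,
      mem_span_w_iff]
  constructor
  · rintro ⟨ha, hb⟩
    exact ⟨h₁.mp ha, h₂.mp hb⟩
  · rintro ⟨ha, hb⟩
    exact ⟨h₁.mpr ha, h₂.mpr hb⟩

theorem mem_fiberPluckerIdeal {F : FiberRing n} :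
    F ∈ fiberPluckerIdeal J ε ↔ ∀ x : ZMod n × Fin n → ℂ, (∀ b, ∃ i, x (b, i) ≠ 0) →
      IsPoint J ε x → MvPolynomial.eval x F = 0 := by
  simp only [fiberPluckerIdeal, fiberVanishingIdeal, Submodule.mem_iInf, RingHom.mem_ker]
  constructor
  · intro h x hx hp
    obtain ⟨U, hU⟩ := exists_represents hx
    exact h U (hU.mem_positroidFiber_iff.mpr hp) x hU
  · intro h U hU x hx
    exact h x hx.exists_ne_zero (hx.mem_positroidFiber_iff.mp hU)

omit [NeZero n] in
theorem mem_globalPluckerIdeal {F : GlobalRing n} :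
    F ∈ globalPluckerIdeal J ↔ ∀ ε, specialize ε F ∈ fiberPluckerIdeal J ε := by
  simp only [fiberPluckerIdeal, fiberVanishingIdeal, globalPluckerIdeal, globalVanishingIdeal,
    Submodule.mem_iInf, RingHom.mem_ker, Prod.forall, evalAt_eq]
  rfl

namespace IsPoint

/-- Composition of the steps from `a + c` to `a + c'`: the coordinate at position `p` picks up `ε`
exactly when the path leaves the vertex `p`, at most once since `c' ≤ n`. The factor `ν` may be
zero. -/
theorem exists_transport (h : IsPoint J ε x) (a : ZMod n) {c c' : ℕ} (hc : c ≤ c') (hn : c' ≤ n) :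
    ∃ ν : ℂ, ∀ p : ZMod n, (if c ≤ (p - a).val ∧ (p - a).val < c' then ε else 1) *
      coord x (a + (c : ZMod n)) p = ν * coord x (a + (c' : ZMod n)) p := by
  induction c', hc using Nat.le_induction with
  | base =>
    refine ⟨1, fun p => ?_⟩
    rw [if_neg (by omega)]
  | succ m hm ih =>
    obtain ⟨ν, hν⟩ := ih (by omega)
    obtain ⟨μ, hμ⟩ := h.step (a + (m : ZMod n))
    refine ⟨ν * μ, fun p => ?_⟩
    have hpm : p = a + (m : ZMod n) ↔ (p - a).val = m := by
      constructor
      · rintro rfl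
        rw [add_sub_cancel_left, ZMod.val_natCast_of_lt (by omega)]
      · rintro rfl
        rw [ZMod.natCast_zmod_val, add_sub_cancel]
    have h₁ := hν p
    have h₂ := hμ p
    rw [Nat.cast_succ, ← add_assoc, mul_assoc, ← h₂, mul_left_comm, ← h₁, ← mul_assoc]
    congr 1
    by_cases hp : (p - a).val = m
    · rw [if_pos (hpm.mpr hp), if_pos (by omega), if_neg (by omega), mul_one]
    · rw [if_neg (fun h' => hp (hpm.mp h')), one_mul]
      exact if_congr (by omega) rfl rfl

/-- Transport from `b` to the vertex `p` does not cross `p`, so no `ε` appears. At the vertex `p`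
the coordinate has index `1`, and it is killed by the Schubert condition. -/
theorem coord_eq_zero (h : IsPoint J ε x) (b : ZMod n) {p : ZMod n} (hp : p ∉ L J) :
    coord x b p = 0 := by
  obtain ⟨ν, hν⟩ := h.exists_transport b (c := 0) (c' := (p - b).val) (Nat.zero_le _)
    (ZMod.val_lt _).le
  have := hν p
  rw [if_neg (by omega), one_mul, Nat.cast_zero, add_zero, ZMod.natCast_zmod_val,
    add_sub_cancel, coord_eq (b := p) (i := ⟨0, (J p).pos⟩) (by simp), h.schubert, mul_zero] at this
  · exact this
  · exact Nat.pos_of_ne_zero hp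

theorem apply_eq_zero (h : IsPoint J ε x) (b : ZMod n) (i : Fin n)
    (hp : b + ((i : ℕ) : ZMod n) ∉ L J) : x (b, i) = 0 := by
  rw [← coord_eq (x := x) rfl, h.coord_eq_zero b hp]

theorem exists_forward (h : IsPoint J ε x) (a c : ZMod n) :
    ∃ ν : ℂ, ∀ i : Fin n, ε ^ wrapCount c i * x (a, i) = ν * x (a + c, shiftBy c i) := by
  obtain ⟨ν, hν⟩ := h.exists_transport a (Nat.zero_le c.val) c.val_lt.le
  refine ⟨ν, fun i => ?_⟩
  have := hν (a + ((i : ℕ) : ZMod n))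
  rw [Nat.cast_zero, add_zero, coord_eq rfl, ZMod.natCast_zmod_val,
    coord_eq (i := shiftBy c i) (by rw [natCast_shiftBy]; ring), add_sub_cancel_left,
    val_natCast_fin] at this
  rw [← this, wrapCount]
  congr 1
  by_cases hi : (i : ℕ) + 1 ≤ c.val
  · rw [if_pos hi, if_pos (by omega), pow_one]
  · rw [if_neg hi, if_neg (by omega), pow_zero]

/-- Transport along the rest of the cycle, from `a + c` to `a + n = a`. -/
theorem exists_backward (h : IsPoint J ε x) (a c : ZMod n) :
    ∃ ν : ℂ, ∀ i : Fin n, ε ^ (1 - wrapCount c i) * x (a + c, shiftBy c i) = ν * x (a, i) := by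
  obtain ⟨ν, hν⟩ := h.exists_transport a c.val_lt.le le_rfl
  refine ⟨ν, fun i => ?_⟩
  have := hν (a + ((i : ℕ) : ZMod n))
  rw [ZMod.natCast_self, add_zero, coord_eq (b := a) rfl, ZMod.natCast_zmod_val,
    coord_eq (i := shiftBy c i) (by rw [natCast_shiftBy]; ring), add_sub_cancel_left,
    val_natCast_fin] at this
  rw [← this, wrapCount]
  congr 1
  by_cases hi : (i : ℕ) + 1 ≤ c.val
  · rw [if_pos hi, if_neg (by omega), Nat.sub_self, pow_zero]
  · rw [if_neg hi, if_pos (by omega), Nat.sub_zero, pow_one]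

end IsPoint

theorem IsPoint.eval_definingRelations (h : IsPoint J ε x) {F : GlobalRing n}
    (hF : F ∈ definingRelations J) : MvPolynomial.eval x (specialize ε F) = 0 := by
  rcases hF with (⟨a, i, hi, rfl⟩ | ⟨a, c, i, j, hd, rfl⟩) | ⟨a, c, i, j, hd, rfl⟩
  · simpa using h.schubert a i (not_le.mp hi)
  all_goals
    obtain ⟨ν, hν⟩ := h.exists_forward a c
    obtain ⟨μ, hμ⟩ := h.exists_backward a c
    have h₁ := hν i
    have h₂ := hν (shiftBy (-c) j)
    have h₃ := hμ i
    have h₄ := hμ (shiftBy (-c) j)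
    rw [shiftBy_shiftBy_neg] at h₂ h₄
    rcases wrapCount_eq_zero_or_one c i with h₅ | h₅ <;>
    rcases wrapCount_eq_zero_or_one c (shiftBy (-c) j) with h₆ | h₆ <;>
    rw [h₅, h₆] at hd <;> try omega
    all_goals
      simp only [h₅, h₆, pow_zero, pow_one, tsub_zero, tsub_self, one_mul] at h₁ h₂ h₃ h₄
      simp only [h₅, h₆, pow_zero, pow_one, tsub_zero, tsub_self, one_mul, map_sub, map_mul,
        specialize_Delta, specialize_eps, MvPolynomial.eval_X, MvPolynomial.eval_C]
  · rw [h₁, h₂]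
    ring
  · rw [h₁, mul_left_comm ε, mul_left_comm, ← mul_assoc ε, h₂]
    ring
  -- Here both indices wrap, and forward transport would give the relation only after multiplication
  -- by `ε`; backward transport carries no `ε`.
  · rw [h₃, h₄]
    ring
  · rw [h₂, ← mul_assoc, h₁]
    ring

end Points

/-! ### Linear independence of the admissible monomials -/

section JugglingPattern

variable {n : ℕ} {J : ZMod n → Fin n}

theorem IsJugglingPattern.apply_add (hJ : IsJugglingPattern J) (b : ZMod n) {i : ℕ}
    (hi : i ≤ (J b : ℕ)) : (J (b + (i : ZMod n)) : ℕ) = J b - i := by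
  induction i with
  | zero => simp
  | succ i ih =>
    have h := ih (by omega)
    rw [Nat.cast_succ, ← add_assoc, hJ _ (by omega), h]
    omega

theorem IsJugglingPattern.nonempty_L (hJ : IsJugglingPattern J) : (L J).Nonempty :=
  ⟨0 + ((J 0 : ℕ) : ZMod n), (hJ.apply_add 0 le_rfl).trans (Nat.sub_self _)⟩

/-- Makes the test points, which are supported on positions in `L J`, satisfy the Schubert
conditions. -/
theorem IsJugglingPattern.notMem_L (hJ : IsJugglingPattern J) {b : ZMod n} {i : Fin n}
    (hi : i < J b) : b + ((i : ℕ) : ZMod n) ∉ L J := by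
  intro h
  have h₁ := hJ.apply_add b (i := i) (Fin.le_def.mp hi.le)
  have h₂ : (J (b + ((i : ℕ) : ZMod n)) : ℕ) = 0 := h
  rw [Fin.lt_def] at hi
  omega

end JugglingPattern

/-! ### Tori of points in the fibers, and extraction of coefficients. -/

section TestPoints

open MvPolynomial

variable {n : ℕ} [NeZero n] {J : ZMod n → Fin n} {ε : ℂ}

theorem val_sub_self_add_one (b : ZMod n) : (b - (b + 1)).val = n - 1 := by
  have hpos : 0 < n := Nat.pos_of_ne_zero (NeZero.ne n)
  have : b - (b + 1) = ((n - 1 : ℕ) : ZMod n) := by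
    rw [Nat.cast_sub hpos, ZMod.natCast_self]
    simp
  rw [this, ZMod.val_natCast_of_lt (by omega)]

theorem val_sub_add_one {b p : ZMod n} (h : p ≠ b) :
    (p - (b + 1)).val + 1 = (p - b).val := by
  have h0 : (p - b).val ≠ 0 := by rwa [Ne, ZMod.val_eq_zero, sub_eq_zero]
  have hlt := ZMod.val_lt (p - b)
  have : p - (b + 1) = (((p - b).val - 1 : ℕ) : ZMod n) := by
    rw [Nat.cast_sub (by omega), ZMod.natCast_zmod_val]
    simp [sub_sub]
  rw [this, ZMod.val_natCast_of_lt (by omega)]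
  omega

open Classical in
/-- The scalar in the coordinate with vertex `b` and position `p` on the component of the fiber that
is given by `t ∈ L(J)`. -/
noncomputable def testScalar (J : ZMod n → Fin n) (ε : ℂ) (t b p : ZMod n) : ℂ :=
  if p ∈ L J then if (t - b).val < (p - b).val then ε else 1 else 0

/-- The coordinates of a point of the fiber over `ε`, on the component given by `t ∈ L(J)`. -/
noncomputable def testPoint (J : ZMod n → Fin n) (ε : ℂ) (t : ZMod n) (z : ZMod n ⊕ ZMod n → ℂ)
    (v : ZMod n × Fin n) : ℂ :=
  testScalar J ε t v.1 (v.1 + ((v.2 : ℕ) : ZMod n)) *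
    (z (Sum.inl v.1) * z (Sum.inr (v.1 + ((v.2 : ℕ) : ZMod n))))

theorem coord_testPoint (t : ZMod n) (z : ZMod n ⊕ ZMod n → ℂ) (b p : ZMod n) :
    coord (testPoint J ε t z) b p =
      testScalar J ε t b p * (z (Sum.inl b) * z (Sum.inr p)) := by
  obtain ⟨i, hi⟩ := exists_fin_natCast (p - b)
  have : b + ((i : ℕ) : ZMod n) = p := by rw [hi, add_sub_cancel]
  rw [coord_eq this, testPoint, this]

/-- The scalar is `ε` when `t` comes strictly before `p` on the way from `b`. This order changes
only when the step leaves `p` or `t`, and the two factors compensate for the change; if `p = t`,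
they agree. -/
theorem testScalar_step (t b p : ZMod n) :
    (if p = b then ε else 1) * testScalar J ε t b p =
      (if b = t then ε else 1) * testScalar J ε t (b + 1) p := by
  unfold testScalar
  by_cases hp : p ∈ L J
  swap
  · simp [hp]
  rw [if_pos hp, if_pos hp]
  have hlt := ZMod.val_lt (t - (b + 1))
  have hlt' := ZMod.val_lt (p - (b + 1))
  by_cases hpb : p = b <;> by_cases hbt : b = t
  · subst hpb hbt
    simp
  · subst hpb
    have := val_sub_self_add_one p
    have := val_sub_add_one (b := p) (p := t) (Ne.symm hbt)
    have := ZMod.val_lt (t - p)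
    rw [if_pos rfl, if_neg hbt, sub_self, ZMod.val_zero, if_neg (by omega), if_pos (by omega)]
    ring
  · subst hbt
    have := val_sub_self_add_one b
    have := val_sub_add_one hpb
    rw [if_neg hpb, if_pos rfl, sub_self, ZMod.val_zero, if_pos (by omega), if_neg (by omega)]
    ring
  · have := val_sub_add_one hpb
    have := val_sub_add_one (b := b) (p := t) (Ne.symm hbt)
    rw [if_neg hpb, if_neg hbt]
    congr 1
    exact if_congr (by omega) rfl rfl

theorem isPoint_testPoint (hJ : IsJugglingPattern J) (t : ZMod n) {z : ZMod n ⊕ ZMod n → ℂ}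
    (hz : ∀ s, z s ≠ 0) : IsPoint J ε (testPoint J ε t z) := by
  refine ⟨fun b => ⟨(if b = t then ε else 1) * (z (Sum.inl b) / z (Sum.inl (b + 1))),
    fun p => ?_⟩, fun b i hi => ?_⟩
  · rw [coord_testPoint, coord_testPoint, ← mul_assoc, testScalar_step]
    have := hz (Sum.inl (b + 1))
    field_simp
  · rw [testPoint, testScalar, if_neg (hJ.notMem_L hi), zero_mul]

theorem testPoint_ne_zero {t : ZMod n} (ht : t ∈ L J) {z : ZMod n ⊕ ZMod n → ℂ}
    (hz : ∀ s, z s ≠ 0) (b : ZMod n) : ∃ i, testPoint J ε t z (b, i) ≠ 0 := by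
  obtain ⟨i, hi⟩ := exists_fin_natCast (t - b)
  refine ⟨i, ?_⟩
  simp [testPoint, testScalar, hi, ht, hz]

/-- The pullback of functions to the component given by `t ∈ L(J)`. -/
noncomputable def testHom (J : ZMod n → Fin n) (ε : ℂ) (t : ZMod n) :
    FiberRing n →ₐ[ℂ] MvPolynomial (ZMod n ⊕ ZMod n) ℂ :=
  aeval fun v => monomial (endpointWeight v)
    (testScalar J ε t v.1 (v.1 + ((v.2 : ℕ) : ZMod n)))

omit [NeZero n] in
theorem eval_testHom (t : ZMod n) (z : ZMod n ⊕ ZMod n → ℂ) (F : FiberRing n) :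
    eval z (testHom J ε t F) = eval (testPoint J ε t z) F := by
  have : (eval z).comp (testHom J ε t : FiberRing n →+* MvPolynomial (ZMod n ⊕ ZMod n) ℂ) =
      eval (testPoint J ε t z) := by
    refine ringHom_ext (fun r => by simp [testHom]) fun v => ?_
    simp [testHom, testPoint, endpointWeight, monomial_add_single, mul_assoc,
      ← C_mul_X_pow_eq_monomial]
  exact DFunLike.congr_fun this F

omit [NeZero n] in
theorem testHom_monomial (t : ZMod n) (e : ZMod n × Fin n →₀ ℕ) (c : ℂ) :
    testHom J ε t (monomial e c) = monomial (endpoints e)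
      (c * e.prod fun v k => testScalar J ε t v.1 (v.1 + ((v.2 : ℕ) : ZMod n)) ^ k) := by
  rw [testHom, aeval_monomial, algebraMap_eq, ← C_mul_monomial]
  congr 1
  induction e using Finsupp.induction_linear with
  | zero => simp
  | add e e' h h' =>
    rw [Finsupp.prod_add_index' (by simp) (by simp [pow_add]), h, h',
      Finsupp.prod_add_index' (by simp) (by simp [pow_add]), monomial_mul, ← map_add]
  | single v k => simp [monomial_pow, Finsupp.weight_single]

/-- Only nonzero values of `z` give points of the product of projective spaces, but these suffice to
show that a polynomial is zero. -/
theorem testHom_eq_zero (hJ : IsJugglingPattern J) {t : ZMod n} (ht : t ∈ L J) {F : FiberRing n}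
    (hF : F ∈ fiberPluckerIdeal J ε) : testHom J ε t F = 0 := by
  refine funext_set (fun _ => {0}ᶜ) (fun _ => (Set.finite_singleton 0).infinite_compl)
    fun z hz => ?_
  have hz' : ∀ s, z s ≠ 0 := fun s => hz s (Set.mem_univ s)
  rw [eval_testHom, map_zero]
  exact mem_fiberPluckerIdeal.mp hF _ (testPoint_ne_zero ht hz') (isPoint_testPoint hJ t hz')

/-- For each `e` in the support, `t` is chosen to be uncovered by `e`. The coefficient of the
pullback at `endpoints e` is then that of `F` at `e`: the scalar is `1`, and no other admissible
monomial has these endpoints. -/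
theorem eq_zero_of_mem_fiberPluckerIdeal (hJ : IsJugglingPattern J) {F : FiberRing n}
    (hF : F ∈ fiberPluckerIdeal J ε) (hadm : ∀ e ∈ F.support, IsAdmissible J e) : F = 0 := by
  ext e
  rw [coeff_zero]
  by_contra he
  have he' := hadm e (mem_support_iff.mpr he)
  obtain ⟨t, ht, hcov⟩ := he'.exists_uncovered hJ.nonempty_L
  have h := congrArg (coeff (endpoints e)) (testHom_eq_zero hJ ht hF)
  rw [F.as_sum, map_sum, coeff_sum, coeff_zero, Finset.sum_eq_single e] at h
  · rw [testHom_monomial, coeff_monomial, if_pos rfl, Finsupp.prod, Finset.prod_eq_one, mul_one] at h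
    · exact he h
    · intro v hv
      rw [Finsupp.mem_support_iff] at hv
      have := hcov v.1 v.2 hv
      rw [testScalar, if_pos (he'.1 v.1 v.2 hv), add_sub_cancel_left, val_natCast_fin,
        if_neg (by omega), one_pow]
  · intro e'' he'' hne
    rw [testHom_monomial, coeff_monomial, if_neg]
    exact fun heq => hne ((hadm e'' he'').eq_of_endpoints_eq he' heq)
  · intro hns
    exact absurd (mem_support_iff.mpr he) hns

theorem eq_zero_of_mem_globalPluckerIdeal (hJ : IsJugglingPattern J) {F : GlobalRing n}
    (hF : F ∈ globalPluckerIdeal J) (hadm : ∀ e ∈ F.support, IsAdmissible J e) : F = 0 := by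
  ext1 e
  refine Polynomial.funext fun ε => ?_
  have h := eq_zero_of_mem_fiberPluckerIdeal hJ (mem_globalPluckerIdeal.mp hF ε)
    fun e he => hadm e (support_map_subset _ F he)
  have := congrArg (coeff e) h
  rw [specialize, coeff_map] at this
  simpa using this

end TestPoints

/-! ### Homogenization on a chart -/

section Homogenization

open MvPolynomial

variable {n : ℕ} [NeZero n] {R : Type*} [CommRing R]

omit [NeZero n] in
theorem isWeightedHomogeneous_chart (σ : ZMod n → Fin n) (s : Finset (ZMod n)) :
    IsWeightedHomogeneous degreeWeight
      (∏ b ∈ s, X (b, σ b) : MvPolynomial (ZMod n × Fin n) R) (∑ b ∈ s, Pi.single b 1) :=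
  IsWeightedHomogeneous.prod s _ _ fun b _ => isWeightedHomogeneous_X R degreeWeight (b, σ b)

theorem sum_pi_single_univ : ∑ b : ZMod n, (Pi.single b 1 : ZMod n → ℕ) = 1 := by
  ext c
  simp [Finset.sum_apply, Pi.single_apply]

/-- A polynomial on the chart given by `σ` is the restriction of a multihomogeneous polynomial that
vanishes outside of the chart. -/
theorem exists_homogenization (σ : ZMod n → Fin n) (F : MvPolynomial (ZMod n × Fin n) R) :
    ∃ N₀ : ℕ, ∀ N, N₀ ≤ N → ∃ G : MvPolynomial (ZMod n × Fin n) R,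
      IsWeightedHomogeneous degreeWeight G (N • (1 : ZMod n → ℕ)) ∧
      F - G ∈ Ideal.span (Set.range fun b : ZMod n =>
        (X (b, σ b) - 1 : MvPolynomial (ZMod n × Fin n) R)) ∧
      ∀ (f : R →+* ℂ) (x : ZMod n × Fin n → ℂ),
        ((∀ b, x (b, σ b) ≠ 0) → eval₂Hom f x G =
          (∏ b, x (b, σ b)) ^ N * eval₂Hom f (fun v => x v / x (v.1, σ v.1)) F) ∧
        ((∃ b, x (b, σ b) = 0) → eval₂Hom f x G = 0) := by
  set A := Ideal.span (Set.range fun b : ZMod n =>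
    (X (b, σ b) - 1 : MvPolynomial (ZMod n × Fin n) R))
  have hA : ∀ b, Ideal.Quotient.mk A (X (b, σ b)) = 1 := fun b =>
    (Ideal.Quotient.eq (I := A)).mpr (Ideal.subset_span ⟨b, rfl⟩)
  induction F using MvPolynomial.induction_on with
  | C a =>
    -- The bound `N ≥ 1` makes even constants vanish outside of the chart.
    refine ⟨1, fun N hN => ⟨C a * (∏ b, X (b, σ b)) ^ N, ?_, ?_, fun f x => ⟨fun _ => ?_, ?_⟩⟩⟩
    · have := ((isWeightedHomogeneous_chart (R := R) σ Finset.univ).pow N).C_mul a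
      rwa [sum_pi_single_univ] at this
    · rw [← Ideal.Quotient.eq]
      simp [map_mul, map_pow, map_prod, hA]
    · simp [map_mul, map_pow, map_prod, mul_comm]
    · rintro ⟨b, hb⟩
      simp only [map_mul, map_pow, map_prod, coe_eval₂Hom, eval₂_X]
      rw [Finset.prod_eq_zero (Finset.mem_univ b) hb, zero_pow (by omega), mul_zero]
  | add F F' ih ih' =>
    obtain ⟨N₁, h₁⟩ := ih
    obtain ⟨N₂, h₂⟩ := ih'
    refine ⟨max N₁ N₂, fun N hN => ?_⟩
    obtain ⟨G, hG, hA₁, hG'⟩ := h₁ N (le_of_max_le_left hN)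
    obtain ⟨G', hG₂, hA₂, hG₂'⟩ := h₂ N (le_of_max_le_right hN)
    refine ⟨G + G', hG.add hG₂, ?_, fun f x => ⟨fun h => ?_, fun h => ?_⟩⟩
    · rw [add_sub_add_comm]
      exact A.add_mem hA₁ hA₂
    · rw [map_add, (hG' f x).1 h, (hG₂' f x).1 h, map_add, mul_add]
    · rw [map_add, (hG' f x).2 h, (hG₂' f x).2 h, add_zero]
  | mul_X F v ih =>
    obtain ⟨b, i⟩ := v
    obtain ⟨N₀, h⟩ := ih
    refine ⟨N₀ + 1, fun N hN => ?_⟩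
    obtain ⟨N, rfl⟩ : ∃ N', N = N' + 1 := ⟨N - 1, by omega⟩
    obtain ⟨G, hG, hA', hG'⟩ := h N (by omega)
    -- The new variable raises the degree at `b` only; the chart variables at the other vertices
    -- restore equal degrees.
    refine ⟨G * (X (b, i) * ∏ c ∈ Finset.univ.erase b, X (c, σ c)), ?_, ?_,
      fun f x => ⟨fun h => ?_, fun h => ?_⟩⟩
    · have := hG.mul ((isWeightedHomogeneous_X R degreeWeight (b, i)).mul
        (isWeightedHomogeneous_chart σ (Finset.univ.erase b)))
      rwa [degreeWeight, Finset.add_sum_erase _ (fun b : ZMod n => (Pi.single b 1 : ZMod n → ℕ))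
        (Finset.mem_univ b), sum_pi_single_univ, ← succ_nsmul] at this
    · rw [← Ideal.Quotient.eq] at hA' ⊢
      simp [map_mul, map_prod, hA, hA']
    · rw [map_mul, (hG' f x).1 h, map_mul, map_mul, map_prod]
      simp only [coe_eval₂Hom, eval₂_X]
      rw [pow_succ, ← Finset.mul_prod_erase _ (fun b => x (b, σ b)) (Finset.mem_univ b)]
      have := h b
      field_simp
    · rw [map_mul, (hG' f x).2 h, zero_mul]

end Homogenization

/-! ### The explicit relations -/

section Relations

open MvPolynomial

variable {n : ℕ} [NeZero n] {J : ZMod n → Fin n} {ε : ℂ}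

omit [NeZero n] in
theorem wrapCount_sub_eq_zero {b b' : ZMod n} {i i' : Fin n} (hi : i' ≤ i)
    (h : b' + ((i' : ℕ) : ZMod n) = b + ((i : ℕ) : ZMod n)) : wrapCount (b' - b) i = 0 := by
  have : b' - b = (((i : ℕ) - (i' : ℕ) : ℕ) : ZMod n) := by
    rw [Nat.cast_sub hi, sub_eq_sub_iff_add_eq_add, h, add_comm]
  rw [wrapCount, this, ZMod.val_natCast_of_lt (by omega), if_neg (by omega)]

/-- With `c = b' - b`, the hypothesis `i' ≤ i` means that `i` does not wrap. Hence the relation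
belongs to the family whose leading product has coefficient `1`. -/
theorem exchange_mem_definingRelations {b b' : ZMod n} {i j i' j' : Fin n} (hi : i' ≤ i)
    (h : b' + ((i' : ℕ) : ZMod n) = b + ((i : ℕ) : ZMod n))
    (h' : b + ((j' : ℕ) : ZMod n) = b' + ((j : ℕ) : ZMod n)) :
    ∃ k : ℕ, Delta b i * Delta b' j - eps ^ k * (Delta b j' * Delta b' i') ∈
      definingRelations J := by
  have h₁ : shiftBy (b' - b) i = i' := shiftBy_eq (by linear_combination -h)
  have h₂ : shiftBy (-(b' - b)) j = j' := shiftBy_eq (by linear_combination -h')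
  refine ⟨wrapCount (b' - b) j' - 0, Or.inl (Or.inr ⟨b, b' - b, i, j, ?_, ?_⟩)⟩
  · rw [wrapCount_sub_eq_zero hi h]
    exact Nat.zero_le _
  · rw [add_sub_cancel, h₁, h₂, wrapCount_sub_eq_zero hi h]

theorem allowsExchange_of_relationIdeal_le {K : Ideal (GlobalRing n)}
    (hK : relationIdeal J ≤ K) : AllowsExchange K := by
  intro b b' i j i' j' hi h h'
  obtain ⟨k, hk⟩ := exchange_mem_definingRelations (J := J) hi h h'
  refine ⟨Polynomial.X ^ k, hK (Ideal.subset_span ?_)⟩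
  rwa [C_pow]

theorem allowsExchange_fiberRelationIdeal : AllowsExchange (fiberRelationIdeal J ε) := by
  intro b b' i j i' j' hi h h'
  obtain ⟨k, hk⟩ := exchange_mem_definingRelations (J := J) hi h h'
  refine ⟨ε ^ k, Ideal.subset_span ⟨_, hk, ?_⟩⟩
  simp

theorem X_mem_relationIdeal {a : ZMod n} {i : Fin n} (hi : i < J a) :
    X (a, i) ∈ relationIdeal J :=
  Ideal.subset_span (Or.inl (Or.inl ⟨a, i, not_le.mpr hi, rfl⟩))

theorem X_mem_fiberRelationIdeal {a : ZMod n} {i : Fin n} (hi : i < J a) :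
    X (a, i) ∈ fiberRelationIdeal J ε :=
  Ideal.subset_span ⟨Delta a i, Or.inl (Or.inl ⟨a, i, not_le.mpr hi, rfl⟩), by simp⟩

theorem fiberRelationIdeal_le : fiberRelationIdeal J ε ≤ fiberPluckerIdeal J ε := by
  refine Ideal.span_le.mpr ?_
  rintro _ ⟨F, hF, rfl⟩
  exact mem_fiberPluckerIdeal.mpr fun x _ hx => hx.eval_definingRelations hF

theorem relationIdeal_le : relationIdeal J ≤ globalPluckerIdeal J :=
  Ideal.span_le.mpr fun _ hF => mem_globalPluckerIdeal.mpr fun _ =>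
    fiberRelationIdeal_le (Ideal.subset_span ⟨_, hF, rfl⟩)

theorem X_mem_globalPluckerIdeal {b : ZMod n} {i : Fin n} (h : b + ((i : ℕ) : ZMod n) ∉ L J) :
    X (b, i) ∈ globalPluckerIdeal J := by
  refine mem_globalPluckerIdeal.mpr fun ε => mem_fiberPluckerIdeal.mpr fun x _ hx => ?_
  simp [specialize, hx.apply_eq_zero b i h]

/-- A monomial with a position outside of `L(J)` at which it also has a vertex is a consequence of
the explicit relations. -/
theorem AllowsExchange.monomial_mem {R : Type*} [CommRing R]
    {K : Ideal (MvPolynomial (ZMod n × Fin n) R)} (hK : AllowsExchange K)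
    (hX : ∀ (a : ZMod n) (i : Fin n), i < J a → X (a, i) ∈ K) {e : ZMod n × Fin n →₀ ℕ}
    {b : ZMod n} {i : Fin n} (hbi : e (b, i) ≠ 0) (hL : b + ((i : ℕ) : ZMod n) ∉ L J)
    (hv : ∃ j, e (b + ((i : ℕ) : ZMod n), j) ≠ 0) : monomial e 1 ∈ K := by
  set p := b + ((i : ℕ) : ZMod n) with hp
  have hXp : X (p, ⟨0, i.pos⟩) ∈ K := hX p _ (Nat.pos_of_ne_zero hL)
  obtain ⟨j, hj⟩ := hv
  by_cases hbp : b = p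
  · have hi : i = ⟨0, i.pos⟩ := natCast_fin_injective (by
      rw [Nat.cast_zero]
      exact left_eq_add.mp (hbp.trans hp))
    rw [← sub_single_add_single hbi, monomial_add_single, pow_one]
    refine K.mul_mem_left _ ?_
    rwa [hbp, hi]
  -- The exchange gives position `p` to the variable with vertex `p`, which becomes the Schubert
  -- relation `Δ^{(p)}_1`.
  · obtain ⟨j', hj'⟩ := exists_fin_natCast (p + ((j : ℕ) : ZMod n) - b)
    obtain ⟨r, hr⟩ := hK b p i j ⟨0, i.pos⟩ j' (Nat.zero_le _) (by simp [hp])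
      (by rw [hj', add_sub_cancel])
    have hmem : X (b, i) * X (p, j) ∈ K := by
      rw [← sub_add_cancel (X (b, i) * X (p, j)) (C r * (X (b, j') * X (p, ⟨0, i.pos⟩)))]
      exact K.add_mem hr (K.mul_mem_left _ (K.mul_mem_left _ hXp))
    have hne : (b, i) ≠ (p, j) := fun h => hbp (congrArg Prod.fst h)
    have hi' : (e - Finsupp.single (p, j) 1 : ZMod n × Fin n →₀ ℕ) (b, i) ≠ 0 := by
      rwa [Finsupp.tsub_apply, Finsupp.single_eq_of_ne hne, tsub_zero]
    rw [← sub_single_add_single hj, ← sub_single_add_single hi', monomial_add_single,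
      monomial_add_single, pow_one, pow_one, mul_assoc]
    exact K.mul_mem_left _ hmem

/-- Multihomogeneous polynomials are sums of admissible ones of the same multidegree, modulo the
explicit relations, provided that the multidegree is positive outside of `L(J)`. -/
theorem AllowsExchange.homogeneous_le {R : Type*} [CommRing R]
    {K : Ideal (MvPolynomial (ZMod n × Fin n) R)} (hK : AllowsExchange K)
    (hX : ∀ (a : ZMod n) (i : Fin n), i < J a → X (a, i) ∈ K) {m : ZMod n → ℕ}
    (hm : ∀ c, c ∉ L J → 0 < m c) :
    weightedHomogeneousSubmodule R degreeWeight m ≤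
      restrictSupport R {e | IsAdmissible J e} ⊔ K.restrictScalars R := by
  rw [weightedHomogeneousSubmodule_eq_finsupp_supported]
  refine (hK.restrictSupport_le (J := J) _ fun e he b i hbi hL => ?_).trans
    (sup_le_sup_right (restrictSupport_mono R fun e he => he.1) _)
  refine hK.monomial_mem hX hbi hL (endpoints_inl_ne_zero.mp ?_)
  have he' : Finsupp.weight degreeWeight e = m := he
  have := hm _ hL
  rw [← he', weight_degreeWeight] at this
  exact this.ne'

/-- Modulo `K`, the polynomial is a combination of admissible monomials. This combination lies in
`I` as well, so independence makes it zero. -/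
theorem mem_of_homogeneous {R : Type*} [CommRing R]
    {K I : Ideal (MvPolynomial (ZMod n × Fin n) R)} (hK : AllowsExchange K)
    (hX : ∀ (a : ZMod n) (i : Fin n), i < J a → X (a, i) ∈ K) (hle : K ≤ I)
    (hI : ∀ F ∈ I, (∀ e ∈ F.support, IsAdmissible J e) → F = 0) {m : ZMod n → ℕ}
    (hm : ∀ c, c ∉ L J → 0 < m c) {F : MvPolynomial (ZMod n × Fin n) R}
    (hF : F ∈ weightedHomogeneousSubmodule R degreeWeight m) (hFI : F ∈ I) : F ∈ K := by
  obtain ⟨G, hG, H, hH, rfl⟩ := Submodule.mem_sup.mp (hK.homogeneous_le hX hm hF)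
  have hG0 : G = 0 := hI G ((I.add_mem_iff_left (hle hH)).mp hFI) hG
  rwa [hG0, zero_add]

theorem mem_fiberRelationIdeal (hJ : IsJugglingPattern J) {m : ZMod n → ℕ}
    (hm : ∀ c, c ∉ L J → 0 < m c) {F : FiberRing n}
    (hF : F ∈ weightedHomogeneousSubmodule ℂ degreeWeight m) (hFI : F ∈ fiberPluckerIdeal J ε) :
    F ∈ fiberRelationIdeal J ε :=
  mem_of_homogeneous allowsExchange_fiberRelationIdeal (fun _ _ => X_mem_fiberRelationIdeal)
    fiberRelationIdeal_le (fun _ h => eq_zero_of_mem_fiberPluckerIdeal hJ h) hm hF hFI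

theorem mem_relationIdeal (hJ : IsJugglingPattern J) {m : ZMod n → ℕ}
    (hm : ∀ c, c ∉ L J → 0 < m c) {F : GlobalRing n}
    (hF : F ∈ weightedHomogeneousSubmodule (Polynomial ℂ) degreeWeight m)
    (hFI : F ∈ globalPluckerIdeal J) : F ∈ relationIdeal J :=
  mem_of_homogeneous (allowsExchange_of_relationIdeal_le le_rfl) (fun _ _ => X_mem_relationIdeal)
    relationIdeal_le (fun _ h => eq_zero_of_mem_globalPluckerIdeal hJ h) hm hF hFI

end Relations

/-! ### Reduced scheme structures -/

section Charts

open MvPolynomial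

variable {n : ℕ} [NeZero n] {J : ZMod n → Fin n}

omit [NeZero n] in
/-- Rescaling the coordinates at each vertex does not change the point. -/
theorem Represents.rescale {x : ZMod n × Fin n → ℂ} {U : ZMod n → Projectivization ℂ (W n)}
    (hx : Represents x U) {r : ZMod n → ℂ} (hr : ∀ b, r b ≠ 0) :
    Represents (fun v => x v / r v.1) U := by
  intro b
  obtain ⟨h, hb⟩ := hx b
  obtain ⟨i, hi⟩ := Function.ne_iff.mp h
  have hi' : x (b, i) ≠ 0 := hi
  refine ⟨Function.ne_iff.mpr ⟨i, div_ne_zero hi' (hr b)⟩, ?_⟩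
  rw [← hb, Projectivization.mk_eq_mk_iff']
  refine ⟨(r b)⁻¹, funext fun i => ?_⟩
  simp [div_eq_inv_mul]

theorem definesReducedFamily (hJ : IsJugglingPattern J) :
    DefinesReducedFamily (relationIdeal J) (globalPositroid J) := by
  intro σ F
  constructor
  · intro hF p hp x hx hσ
    suffices hle : relationIdeal J ⊔ Ideal.span (Set.range fun b : ZMod n =>
        (X (b, σ b) - 1 : GlobalRing n)) ≤ RingHom.ker (evalAt p.1 x) from hle hF
    refine sup_le (fun G hG => ?_) (Ideal.span_le.mpr ?_)
    · have := relationIdeal_le hG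
      simp only [globalPluckerIdeal, globalVanishingIdeal, Submodule.mem_iInf] at this
      exact this p hp x hx
    · rintro _ ⟨b, rfl⟩
      simp [evalAt, hσ b]
  · intro hF
    obtain ⟨N, h⟩ := exists_homogenization σ F
    -- The degree `N + 1` is positive at every vertex, so the comparison of the two ideals applies
    -- to `G`.
    obtain ⟨G, hG, hFG, heval⟩ := h (N + 1) (Nat.le_succ N)
    have hGI : G ∈ globalPluckerIdeal J := by
      simp only [globalPluckerIdeal, globalVanishingIdeal, Submodule.mem_iInf, RingHom.mem_ker]
      intro p hp x hx
      by_cases hσ : ∃ b, x (b, σ b) = 0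
      · exact (heval _ x).2 hσ
      · push Not at hσ
        refine ((heval _ x).1 hσ).trans (mul_eq_zero_of_right _ ?_)
        exact hF p hp _ (hx.rescale hσ) fun b => div_self (hσ b)
    rw [← sub_add_cancel F G]
    exact add_mem (Ideal.mem_sup_right hFG)
      (Ideal.mem_sup_left (mem_relationIdeal hJ (fun c _ => by simp) hG hGI))

theorem definesReducedFiber (hJ : IsJugglingPattern J) (ε : ℂ) :
    DefinesReducedFiber (fiberRelationIdeal J ε) (positroidFiber J ε) := by
  intro σ F
  constructor
  · intro hF U hU x hx hσ
    suffices hle : fiberRelationIdeal J ε ⊔ Ideal.span (Set.range fun b : ZMod n =>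
        (X (b, σ b) - 1 : FiberRing n)) ≤ RingHom.ker (eval x) from hle hF
    refine sup_le (fun G hG => ?_) (Ideal.span_le.mpr ?_)
    · have := fiberRelationIdeal_le hG
      simp only [fiberPluckerIdeal, fiberVanishingIdeal, Submodule.mem_iInf] at this
      exact this U hU x hx
    · rintro _ ⟨b, rfl⟩
      simp [hσ b]
  · intro hF
    obtain ⟨N, h⟩ := exists_homogenization σ F
    obtain ⟨G, hG, hFG, heval⟩ := h (N + 1) (Nat.le_succ N)
    have hGI : G ∈ fiberPluckerIdeal J ε := by
      simp only [fiberPluckerIdeal, fiberVanishingIdeal, Submodule.mem_iInf, RingHom.mem_ker]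
      intro U hU x hx
      by_cases hσ : ∃ b, x (b, σ b) = 0
      · exact (heval (RingHom.id ℂ) x).2 hσ
      · push Not at hσ
        refine ((heval (RingHom.id ℂ) x).1 hσ).trans (mul_eq_zero_of_right _ ?_)
        exact hF U hU _ (hx.rescale hσ) fun b => div_self (hσ b)
    rw [← sub_add_cancel F G]
    exact add_mem (Ideal.mem_sup_right hFG)
      (Ideal.mem_sup_left (mem_fiberRelationIdeal hJ (fun c _ => by simp) hG hGI))

end Charts

/-! ### The basis of the global Plücker algebra -/

section Basis

open MvPolynomial

variable {n : ℕ} [NeZero n] {J : ZMod n → Fin n}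

theorem _root_.LinearIndependent.iSupIndep_span_fibers {R M ι κ : Type*} [Ring R] [AddCommGroup M]
    [Module R M] {v : ι → M} (hv : LinearIndependent R v) (d : ι → κ) :
    iSupIndep fun k => Submodule.span R (v '' {i | d i = k}) := by
  intro k
  refine (hv.disjoint_span_image (s := {i | d i = k}) (t := {i | d i ≠ k})
    (Set.disjoint_left.mpr fun i hi hi' => hi' hi)).mono_right (iSup₂_le fun k' hk' => ?_)
  refine Submodule.span_mono (Set.image_mono fun i hi => ?_)
  exact fun h => hk' (hi.symm.trans h)

theorem _root_.LinearIndependent.exists_basis_of_eq_span {R M ι : Type*} [Ring R] [AddCommGroup M]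
    [Module R M] {v : ι → M} (hv : LinearIndependent R v) {P : Submodule R M}
    (hP : P = Submodule.span R (Set.range v)) :
    ∃ B : Module.Basis ι R P, ∀ i, (B i : M) = v i := by
  subst hP
  exact ⟨Module.Basis.span hv, fun i => by rw [Module.Basis.span_apply]⟩

theorem linearIndependent_pluckerMonomial (hJ : IsJugglingPattern J) :
    LinearIndependent (Polynomial ℂ)
      fun e : {e : ZMod n × Fin n →₀ ℕ // IsAdmissible J e} => pluckerMonomial J e.1 := by
  have hli : LinearIndependent (Polynomial ℂ)
      fun e : {e : ZMod n × Fin n →₀ ℕ // IsAdmissible J e} => (monomial e.1 1 : GlobalRing n) := by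
    have := (basisMonomials (ZMod n × Fin n) (Polynomial ℂ)).linearIndependent.comp _
      (Subtype.val_injective (p := IsAdmissible J))
    rwa [coe_basisMonomials] at this
  rw [linearIndependent_iff] at hli ⊢
  intro l hl
  refine hli l (eq_zero_of_mem_globalPluckerIdeal hJ ?_ ?_)
  · refine Ideal.Quotient.eq_zero_iff_mem.mp (Eq.trans ?_ hl)
    exact Finsupp.apply_linearCombination (Polynomial ℂ)
      (Ideal.Quotient.mkₐ (Polynomial ℂ) (globalPluckerIdeal J)).toLinearMap _ l
  · change _ ∈ restrictSupport (Polynomial ℂ) {e | IsAdmissible J e}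
    rw [restrictSupport_eq_span, Set.image_eq_range]
    refine (Finsupp.range_linearCombination (Polynomial ℂ)).le ?_
    exact LinearMap.mem_range_self _ l

omit [NeZero n] in
theorem map_restrictSupport (S : Set (ZMod n × Fin n →₀ ℕ)) :
    (restrictSupport (Polynomial ℂ) S).map
      (Ideal.Quotient.mkₐ (Polynomial ℂ) (globalPluckerIdeal J)).toLinearMap =
      Submodule.span (Polynomial ℂ) (pluckerMonomial J '' S) := by
  rw [restrictSupport_eq_span, Submodule.map_span, Set.image_image]
  rfl

/-- No positivity of the multidegree is needed: in the full vanishing ideal, variables with position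
outside of `L J` are already zero. -/
theorem span_pluckerMonomial_le (S : Set (ZMod n × Fin n →₀ ℕ)) :
    Submodule.span (Polynomial ℂ) (pluckerMonomial J '' S) ≤
      Submodule.span (Polynomial ℂ) (pluckerMonomial J ''
        {e | IsAdmissible J e ∧ ∃ e' ∈ S, endpoints e = endpoints e'}) := by
  rw [← map_restrictSupport, ← map_restrictSupport]
  have hK := allowsExchange_of_relationIdeal_le (relationIdeal_le (J := J))
  refine (Submodule.map_mono (hK.restrictSupport_le (J := J) S fun e _ b i hbi hL => ?_)).trans ?_
  · rw [← sub_single_add_single hbi, monomial_add_single, pow_one]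
    exact Ideal.mul_mem_left _ _ (X_mem_globalPluckerIdeal hL)
  · rw [Submodule.map_sup]
    refine sup_le le_rfl ?_
    rintro _ ⟨F, hF, rfl⟩
    convert Submodule.zero_mem _
    exact Ideal.Quotient.eq_zero_iff_mem.mpr hF

theorem pluckerComponent_eq_span (m : ZMod n → ℕ) :
    pluckerComponent J m = Submodule.span (Polynomial ℂ) (pluckerMonomial J ''
      {e | IsAdmissible J e ∧ Finsupp.weight degreeWeight e = m}) := by
  rw [pluckerComponent, weightedHomogeneousSubmodule_eq_finsupp_supported]
  refine (map_restrictSupport _).trans (le_antisymm ?_ ?_)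
  · refine (span_pluckerMonomial_le _).trans (Submodule.span_mono (Set.image_mono ?_))
    rintro e ⟨he, e', he', h⟩
    exact ⟨he, (weight_degreeWeight_eq h).trans he'⟩
  · exact Submodule.span_mono (Set.image_mono fun e he => he.2)

theorem span_pluckerMonomial :
    Submodule.span (Polynomial ℂ) (pluckerMonomial J '' {e | IsAdmissible J e}) = ⊤ := by
  rw [eq_top_iff]
  have h : Submodule.span (Polynomial ℂ) (pluckerMonomial J '' Set.univ) = ⊤ := by
    rw [← map_restrictSupport, restrictSupport_univ, Submodule.map_top, LinearMap.range_eq_top]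
    exact Ideal.Quotient.mk_surjective
  rw [← h]
  exact (span_pluckerMonomial_le _).trans (Submodule.span_mono (Set.image_mono fun e he => he.1))

theorem exists_basis (hJ : IsJugglingPattern J) :
    ∃ B : Module.Basis {e : ZMod n × Fin n →₀ ℕ // IsAdmissible J e} (Polynomial ℂ)
      (GlobalPluckerAlgebra J), ∀ e, B e = pluckerMonomial J e.1 := by
  refine ⟨Module.Basis.mk (linearIndependent_pluckerMonomial hJ) ?_, fun e => ?_⟩
  · rw [← span_pluckerMonomial, Set.image_eq_range]
    rfl
  · rw [Module.Basis.mk_apply]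

theorem exists_basis_pluckerComponent (hJ : IsJugglingPattern J) (m : ZMod n → ℕ) :
    ∃ B : Module.Basis
        {e : ZMod n × Fin n →₀ ℕ // IsAdmissible J e ∧ Finsupp.weight degreeWeight e = m}
        (Polynomial ℂ) (pluckerComponent J m),
      ∀ e, (B e : GlobalPluckerAlgebra J) = pluckerMonomial J e.1 := by
  have hli := (linearIndependent_pluckerMonomial hJ).comp
    (fun e : {e : ZMod n × Fin n →₀ ℕ //
      IsAdmissible J e ∧ Finsupp.weight degreeWeight e = m} => ⟨e.1, e.2.1⟩)
    fun e e' h => Subtype.ext (congrArg (fun e => e.1) h)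
  refine hli.exists_basis_of_eq_span ?_
  rw [pluckerComponent_eq_span, Set.image_eq_range]
  rfl

theorem isInternal_pluckerComponent (hJ : IsJugglingPattern J) [DecidableEq (ZMod n → ℕ)] :
    DirectSum.IsInternal (pluckerComponent J) := by
  have hcomp : pluckerComponent J = fun m => Submodule.span (Polynomial ℂ)
      ((fun e : {e : ZMod n × Fin n →₀ ℕ // IsAdmissible J e} => pluckerMonomial J e.1) ''
        {e | Finsupp.weight degreeWeight e.1 = m}) := by
    ext1 m
    rw [pluckerComponent_eq_span]
    congr 1
    ext y
    constructor
    · rintro ⟨e, ⟨he, hm⟩, rfl⟩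
      exact ⟨⟨e, he⟩, hm, rfl⟩
    · rintro ⟨⟨e, he⟩, hm, rfl⟩
      exact ⟨e, ⟨he, hm⟩, rfl⟩
  refine DirectSum.isInternal_submodule_of_iSupIndep_of_iSup_eq_top ?_ ?_
  · rw [hcomp]
    exact (linearIndependent_pluckerMonomial hJ).iSupIndep_span_fibers _
  · rw [eq_top_iff, ← span_pluckerMonomial, Submodule.span_le]
    rintro _ ⟨e, he, rfl⟩
    refine Submodule.mem_iSup_of_mem (Finsupp.weight degreeWeight e) ?_
    rw [pluckerComponent_eq_span]
    exact Submodule.subset_span ⟨e, ⟨he, rfl⟩, rfl⟩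

end Basis

end GlobalPositroid

theorem mainTheorem6 {n : ℕ} [NeZero n] (hn : 2 ≤ n) (J : ZMod n → Fin n)
    (hJ : IsJugglingPattern J) :
    -- the admissible monomials form a basis of the global Plücker algebra over `ℂ[ε]`
    (∃ B : Module.Basis {e : ZMod n × Fin n →₀ ℕ // IsAdmissible J e} (Polynomial ℂ)
        (GlobalPluckerAlgebra J),
      ∀ e, B e = pluckerMonomial J e.1) ∧
    -- the algebra is multigraded, and the basis is compatible with the multigrading
    DirectSum.IsInternal (pluckerComponent J) ∧
    (∀ m : ZMod n → ℕ,
      ∃ B : Module.Basis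
          {e : ZMod n × Fin n →₀ ℕ // IsAdmissible J e ∧ Finsupp.weight degreeWeight e = m}
          (Polynomial ℂ) (pluckerComponent J m),
        ∀ e, (B e : GlobalPluckerAlgebra J) = pluckerMonomial J e.1) ∧
    -- the explicit relations define the reduced scheme structure of the family
    DefinesReducedFamily (relationIdeal J) (globalPositroid J) ∧
    relationIdeal J ≤ globalPluckerIdeal J ∧
    (∀ m : ZMod n → ℕ, (∀ c, c ∉ L J → 0 < m c) →
      ∀ F ∈ MvPolynomial.weightedHomogeneousSubmodule (Polynomial ℂ) degreeWeight m,
        F ∈ relationIdeal J ↔ F ∈ globalPluckerIdeal J) ∧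
    -- their specializations define the reduced scheme structure of every fiber
    (∀ ε : ℂ,
      DefinesReducedFiber (fiberRelationIdeal J ε) (positroidFiber J ε) ∧
      fiberRelationIdeal J ε ≤ fiberPluckerIdeal J ε ∧
      ∀ m : ZMod n → ℕ, (∀ c, c ∉ L J → 0 < m c) →
        ∀ F ∈ MvPolynomial.weightedHomogeneousSubmodule ℂ degreeWeight m,
          F ∈ fiberRelationIdeal J ε ↔ F ∈ fiberPluckerIdeal J ε) := by
  exact ⟨exists_basis hJ, isInternal_pluckerComponent hJ, exists_basis_pluckerComponent hJ,
    definesReducedFamily hJ, relationIdeal_le,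
    fun _ hm _ hF => ⟨fun h => relationIdeal_le h, mem_relationIdeal hJ hm hF⟩,
    fun ε => ⟨definesReducedFiber hJ ε, fiberRelationIdeal_le,
      fun _ hm _ hF => ⟨fun h => fiberRelationIdeal_le h, mem_fiberRelationIdeal hJ hm hF⟩⟩⟩
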